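/- **Setting.** There are $n\ge 3f+1$ nodes, at most $f$ of them Byzantine; the others are correct. The network is eventually synchronous with gossip: there are a time GST and a bound $\Delta>0$ such that a message sent or received by a correct node at time $t$ is received by every correct node before $\max(t,\mathrm{GST})+\Delta$. Messages are signed and local computation takes no time. A *block* $v$ is a list of transactions with execution results; each transaction $tx$ in $v$ has an endorsement policy, a monotone condition on sets of nodes. Let $Q=\lfloor (n+f)/2\rfloor+1$ (so $Q=2f+1$ if $n=3f+1$); all counts of messages below are counts of distinct senders. **Protocol.** The nodes run the FlexTender protocol (Tendermint with endorsements). In round $r$ of height $h$ a correct node behaves as follows. * *Propose.* The proposer broadcasts a proposal $(v,vr,rr)$: its valid value with its valid round $vr$ and reference round $rr$, if it has one; otherwise ($vr=-1$) its referenced value without the first transaction whose removal $f+1$ nodes suggested in round $rr$; otherwise a new value. A node in the propose phase acts on a proposal once its reference check succeeds: if $vr=-1$, the check requires that $rr=-1$ and that it knows no reference round itself, or that some $v'$ containing $v$ got $Q$ precommits in round $rr$ with at least $f+1$ of them suggesting the removal of each transaction of $v'$ missing in $v$; if $vr\neq-1$, that $v$ got $Q$ prevotes in round $vr$ and was properly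 endorsed in round $rr$. It then broadcasts a prevote for $v$ if $v$ is valid and Tendermint's locking rule permits, and a prevote for $nil$ otherwise; it also prevotes $nil$ if its propose timer expires first. Either moves it to the prevote phase. When $vr=-1$, a prevote for $v$ states which transactions of $v$ the node endorses; it opposes the others. Every correct node always broadcasts its endorsements for the first valid proposal with $vr=-1$ it gets in the round, even when it does not vote for it (because it is locked, cannot verify the reference, or has already voted $nil$ or entered a later phase); the message is then flagged as carrying endorsements only and is not counted as a vote. * *Prevote.* In the prevote phase, on $Q$ votes of any kind the node starts the prevote timer, of duration $2\Delta$. On $Q$ votes for $v$, if $v$ is properly endorsed by the prevotes of round $r$ or $rr$, it locks $v$ and precommits $v$. On $Q$ votes for $nil$ it precommits $nil$. If it receives proposals of two different blocks of the round before entering the precommit phase, it precommits $nil$ at once. *Rapid removal:* on $Q$ votes for $v$ with $vr=-1$, if every transaction of $v$ is properly endorsed or vetoed, and not all are properly endorsed, it precommits $v$ and suggests removing those not properly endorsed. When the prevote timer expires, it precommits $v$, suggesting the removal of all transactions of $v$ that are not properly endorsed by the prevotes of round $r$, if it has a proposal of $v$ with $vr=-1$ and $Q$ votes for $v$, and $nil$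 otherwise. Each of these precommits moves it to the precommit phase. * *Precommit and advance.* $Q$ precommits of any kind start the precommit timer, whose expiry starts round $r+1$, as do $Q$ precommits for the same $v$. $Q$ precommits for $v$ without suggested removals commit $v$ and start the next height. Messages of a later round from $f+1$ nodes start that round. Valid and reference values are updated as in FlexTender. Here $tx$ is *properly endorsed* by a set of prevotes for $v$ if the nodes endorsing $tx$ satisfy its policy, where two prevotes for $v$ by one node in one round with differing endorsements count as endorsing everything. It is *vetoed* (can be rapidly removed) if the nodes that do not oppose $tx$ fail to satisfy its policy, where nodes counted as endorsing $tx$ do not count as opposing it. **Invariant (censorship resistance).** Consider any run, any round $r$ of any height $h$ that takes place after GST (no correct node sends a prevote of that round before GST), any block $v$ and any transaction $tx$. Suppose that the correct nodes that decide to endorse $tx$ when executing $v$ in round $r$ satisfy the policy of $tx$, and that $tx$ cannot be rapidly removed from $v$ in round $r$ (at no time has a correct node received prevotes of round $r$ by which $tx$ is vetoed). Then no correct node ever broadcasts a precommit of round $r$ for $v$ that suggests removing $tx$. This holds for every proposer, including one that sends different proposals to different nodes. -/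

import Mathlib

namespace FlexTender

/-! ## Blocks, messages, parameters -/

/-- A value: an ordered list of transactions together with their execution results. -/
structure Block (Tx Res : Type*) where
  txs : List Tx
  res : Res

/-- Message bodies. A round number `-1` means "none"; `none` as a value means `nil`.
* `proposal v vr rr`: the value, the proposer's `validRound` and `refRound`.
* `prevote v D con`: `D = some S` says that exactly the transactions of `v` in `S` are endorsed and
  all others opposed; `D = none` carries no view on the transactions. Only messages with
  `con = true` are votes at the consensus layer; with `con = false` the message carries
  endorsements only.
* `precommit v R`: a precommit for `v` that suggests removing the transactions in `R`.

Values are sent instead of their hashes (an ideal hash). -/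
inductive Body (Tx Res : Type*) where
  | proposal (v : Block Tx Res) (vr rr : ℤ)
  | prevote (v : Option (Block Tx Res)) (D : Option (Set Tx)) (con : Bool)
  | precommit (v : Option (Block Tx Res)) (R : Set Tx)

/-- A signed message; forwarding by gossip keeps the original sender. -/
structure Msg (n : ℕ) (Tx Res : Type*) where
  sender : Fin n
  height : ℕ
  round : ℕ
  body : Body Tx Res

/-- The parameters of the protocol for `n` nodes.
`policy h v tx A` says that the endorsements of the nodes in `A` properly endorse `tx` in `v`
(a monotone condition on `A`); `endorse p h r v` is the set of transactions that node `p`, when it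
executes `v` in round `r` of height `h`, decides to endorse. -/
structure Protocol (n : ℕ) (Tx Res : Type*) where
  /-- the bound on the number of faulty nodes -/
  f : ℕ
  proposer : ℕ → ℕ → Fin n
  valid : ℕ → Block Tx Res → Prop
  exec : ℕ → List Tx → Res
  policy : ℕ → Block Tx Res → Tx → Set (Fin n) → Prop
  policy_mono : ∀ h v tx A B, A ⊆ B → policy h v tx A → policy h v tx B
  endorse : Fin n → ℕ → ℕ → Block Tx Res → Set Tx
  /-- the bound on message delays after GST -/
  Δ : ℝ
  Δ_pos : 0 < Δ
  timeoutPropose : ℕ → ℝ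
  timeoutPropose_pos : ∀ r, 0 < timeoutPropose r
  timeoutPrecommit : ℕ → ℝ
  timeoutPrecommit_pos : ∀ r, 0 < timeoutPrecommit r

/-- The duration of the prevote timer. -/
def Protocol.timeoutPrevote {n : ℕ} {Tx Res : Type*} (P : Protocol n Tx Res) : ℝ := 2 * P.Δ

/-- The quorum size, which is `2f+1` when `n = 3f+1`. -/
def Protocol.quorum {n : ℕ} {Tx Res : Type*} (P : Protocol n Tx Res) : ℕ := (n + P.f) / 2 + 1

/-! ## What a node reads off the set `L` of messages it has received -/

/-- The proposal `(v, vr, rr)` of round `r` was received from the proposer of that round. -/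
def HasProposal {n : ℕ} {Tx Res : Type*} (P : Protocol n Tx Res) (L : Set (Msg n Tx Res))
    (h r : ℕ) (v : Block Tx Res) (vr rr : ℤ) : Prop :=
  ⟨P.proposer h r, h, r, .proposal v vr rr⟩ ∈ L

/-- Nodes whose consensus vote in the prevote phase is `v` (a value or `nil`). -/
def prevoters {n : ℕ} {Tx Res : Type*} (L : Set (Msg n Tx Res)) (h r : ℕ)
    (v : Option (Block Tx Res)) : Set (Fin n) :=
  {i | ∃ D, ⟨i, h, r, .prevote v D true⟩ ∈ L}

/-- Nodes that cast any consensus vote in the prevote phase. -/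
def anyPrevoters {n : ℕ} {Tx Res : Type*} (L : Set (Msg n Tx Res)) (h r : ℕ) : Set (Fin n) :=
  {i | ∃ v D, ⟨i, h, r, .prevote v D true⟩ ∈ L}

/-- Nodes that sent a precommit for `v`, with or without suggested removals. -/
def precommitters {n : ℕ} {Tx Res : Type*} (L : Set (Msg n Tx Res)) (h r : ℕ)
    (v : Block Tx Res) : Set (Fin n) :=
  {i | ∃ R, ⟨i, h, r, .precommit (some v) R⟩ ∈ L}

/-- Nodes that sent a precommit for `v` without suggested removals. -/
def cleanPrecommitters {n : ℕ} {Tx Res : Type*} (L : Set (Msg n Tx Res)) (h r : ℕ)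
    (v : Block Tx Res) : Set (Fin n) :=
  {i | ⟨i, h, r, .precommit (some v) ∅⟩ ∈ L}

/-- Nodes that sent any precommit. -/
def anyPrecommitters {n : ℕ} {Tx Res : Type*} (L : Set (Msg n Tx Res)) (h r : ℕ) : Set (Fin n) :=
  {i | ∃ v R, ⟨i, h, r, .precommit v R⟩ ∈ L}

/-- Nodes that sent a precommit for `v` suggesting the removal of `tx`. -/
def removers {n : ℕ} {Tx Res : Type*} (L : Set (Msg n Tx Res)) (h r : ℕ)
    (v : Block Tx Res) (tx : Tx) : Set (Fin n) :=
  {i | ∃ R, ⟨i, h, r, .precommit (some v) R⟩ ∈ L ∧ tx ∈ R}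

/-- Nodes from which any message of round `r` was received. -/
def roundSenders {n : ℕ} {Tx Res : Type*} (L : Set (Msg n Tx Res)) (h r : ℕ) : Set (Fin n) :=
  {i | ∃ b, ⟨i, h, r, b⟩ ∈ L}

/-- Nodes counted as endorsing `tx` in `v` in round `r`. Two prevotes of one node for `v` with
differing endorsements jointly count as an endorsement of every transaction. -/
def endorsers {n : ℕ} {Tx Res : Type*} (L : Set (Msg n Tx Res)) (h r : ℕ)
    (v : Block Tx Res) (tx : Tx) : Set (Fin n) :=
  {i | (∃ D c, ⟨i, h, r, .prevote (some v) (some D) c⟩ ∈ L ∧ tx ∈ D) ∨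
    ∃ D c D' c', ⟨i, h, r, .prevote (some v) (some D) c⟩ ∈ L ∧
      ⟨i, h, r, .prevote (some v) (some D') c'⟩ ∈ L ∧ D ≠ D'}

/-- Nodes counted as opposing `tx` in `v` in round `r`. -/
def opposers {n : ℕ} {Tx Res : Type*} (L : Set (Msg n Tx Res)) (h r : ℕ)
    (v : Block Tx Res) (tx : Tx) : Set (Fin n) :=
  {i | (∃ D c, ⟨i, h, r, .prevote (some v) (some D) c⟩ ∈ L ∧ tx ∉ D) ∧
    i ∉ endorsers L h r v tx}

/-- The prevotes of round `r` make `tx` properly endorsed. -/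
def ProperlyEndorsed {n : ℕ} {Tx Res : Type*} (P : Protocol n Tx Res) (L : Set (Msg n Tx Res))
    (h r : ℕ) (v : Block Tx Res) (tx : Tx) : Prop :=
  P.policy h v tx (endorsers L h r v tx)

/-- The prevotes of round `r` allow `tx` to be rapidly removed: so many endorsers oppose it that the
remaining nodes cannot satisfy its policy. -/
def Vetoed {n : ℕ} {Tx Res : Type*} (P : Protocol n Tx Res) (L : Set (Msg n Tx Res))
    (h r : ℕ) (v : Block Tx Res) (tx : Tx) : Prop :=
  ¬ P.policy h v tx (opposers L h r v tx)ᶜ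

def VerifyEndorsement {n : ℕ} {Tx Res : Type*} (P : Protocol n Tx Res) (L : Set (Msg n Tx Res))
    (h : ℕ) (rr : ℤ) (v : Block Tx Res) : Prop :=
  ∃ r : ℕ, rr = r ∧ ∀ tx ∈ v.txs, ProperlyEndorsed P L h r v tx

def VerifyReference {n : ℕ} {Tx Res : Type*} (P : Protocol n Tx Res) (L : Set (Msg n Tx Res))
    (h : ℕ) (rr : ℤ) (v : Block Tx Res) : Prop :=
  ∃ r : ℕ, rr = r ∧ ∃ v' : Block Tx Res, P.quorum ≤ (precommitters L h r v').ncard ∧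
    v.txs.Sublist v'.txs ∧
    ∀ tx ∈ v'.txs, tx ∉ v.txs → P.f + 1 ≤ (removers L h r v' tx).ncard

/-- `GetExcludedTx`: the transactions of `v` that lack sufficient endorsements. -/
def excludedTx {n : ℕ} {Tx Res : Type*} (P : Protocol n Tx Res) (L : Set (Msg n Tx Res))
    (h r : ℕ) (v : Block Tx Res) : Set Tx :=
  {tx | tx ∈ v.txs ∧ ¬ ProperlyEndorsed P L h r v tx}

/-- `w` is obtained from `v` by deleting the first transaction whose removal at least `f+1` nodes
suggested in round `rr` (if there is one) and re-executing the rest. -/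
def Extract {n : ℕ} {Tx Res : Type*} (P : Protocol n Tx Res) (L : Set (Msg n Tx Res))
    (h : ℕ) (rr : ℤ) (v w : Block Tx Res) : Prop :=
  let removable : Tx → Prop := fun tx => ∃ r : ℕ, rr = r ∧ P.f + 1 ≤ (removers L h r v tx).ncard
  (∃ l₁ tx l₂, v.txs = l₁ ++ tx :: l₂ ∧ (∀ a ∈ l₁, ¬ removable a) ∧ removable tx ∧
    w = ⟨l₁ ++ l₂, P.exec h (l₁ ++ l₂)⟩) ∨
  ((∀ a ∈ v.txs, ¬ removable a) ∧ w = v)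

/-! ## Local states of correct nodes -/

inductive Phase where
  | boot
  | propose
  | prevote
  | precommit

/-- A timer of the current round: not yet started, running with a deadline, or expired. -/
inductive Timer where
  | off
  | on (deadline : ℝ)
  | expired

structure NodeState (n : ℕ) (Tx Res : Type*) where
  height : ℕ
  round : ℕ
  phase : Phase
  /-- all messages received so far -/
  log : Set (Msg n Tx Res)
  decision : ℕ → Option (Block Tx Res)
  lockedValue : Option (Block Tx Res)
  lockedRound : ℤ
  validValue : Option (Block Tx Res)
  validRound : ℤ
  refValue : Option (Block Tx Res)
  refRound : ℤ
  tmrP : Timer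
  tmrV : Timer
  tmrC : Timer
  /-- whether the endorsements for a proposal of the current round have been broadcast -/
  endorsed : Bool

def NodeState.init (n : ℕ) (Tx Res : Type*) : NodeState n Tx Res where
  height := 0
  round := 0
  phase := .boot
  log := ∅
  decision := fun _ => none
  lockedValue := none
  lockedRound := -1
  validValue := none
  validRound := -1
  refValue := none
  refRound := -1
  tmrP := .off
  tmrV := .off
  tmrC := .off
  endorsed := false

/-- The value that a proposer in state `s` proposes; a fresh value is arbitrary. -/
def NextValue {n : ℕ} {Tx Res : Type*} (P : Protocol n Tx Res) (s : NodeState n Tx Res)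
    (v : Block Tx Res) : Prop :=
  match s.validValue, s.refValue with
  | some w, _ => v = w
  | none, some w => Extract P s.log s.height s.refRound w v
  | none, none => True

open Classical in
/-- Node `p` in state `s` starts round `r` of its current height at time `now`, passing to state
`s'` and broadcasting the messages in `out`. -/
def StartRound {n : ℕ} {Tx Res : Type*} (P : Protocol n Tx Res) (p : Fin n) (now : ℝ)
    (s : NodeState n Tx Res) (r : ℕ) (s' : NodeState n Tx Res) (out : Set (Msg n Tx Res)) : Prop :=
  s' = { s with
    round := r
    phase := .propose
    tmrP := if P.proposer s.height r = p then .off else .on (now + P.timeoutPropose r)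
    tmrV := .off
    tmrC := .off
    endorsed := false } ∧
  if P.proposer s.height r = p then
    ∃ v, NextValue P s v ∧ out = {⟨p, s.height, r, .proposal v s.validRound s.refRound⟩}
  else out = ∅

/-- The condition on a proposal without a valid round: it refers to no round and the node knows of
no examined value, or its reference can be verified. -/
def ReferenceOK {n : ℕ} {Tx Res : Type*} (P : Protocol n Tx Res) (s : NodeState n Tx Res)
    (rr : ℤ) (v : Block Tx Res) : Prop :=
  (rr = -1 ∧ s.refRound = -1) ∨ VerifyReference P s.log s.height rr v

/-- The transactions of `v` endorsed by `p`. -/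
def endorsedTx {n : ℕ} {Tx Res : Type*} (P : Protocol n Tx Res) (p : Fin n) (h r : ℕ)
    (v : Block Tx Res) : Set Tx :=
  {tx | tx ∈ v.txs ∧ tx ∈ P.endorse p h r v}

/-- The "upon" rules: `Rule P p now s s' out` says that at time `now` a rule of node `p` is enabled
in state `s` and leads to `s'`, broadcasting the messages in `out`. -/
inductive Rule {n : ℕ} {Tx Res : Type*} (P : Protocol n Tx Res) (p : Fin n) (now : ℝ) :
    NodeState n Tx Res → NodeState n Tx Res → Set (Msg n Tx Res) → Prop where
  | start (s s' out) (hphase : s.phase = .boot) (hs : StartRound P p now s 0 s' out) :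
      Rule P p now s s' out
  /-- A new proposal is approved: prevote for it, with endorsements. -/
  | approveNew (s v rr) (hphase : s.phase = .propose)
      (hprop : HasProposal P s.log s.height s.round v (-1) rr) (href : ReferenceOK P s rr v)
      (hvalid : P.valid s.height v) (hlock : s.lockedRound = -1 ∨ s.lockedValue = some v) :
      Rule P p now s { s with phase := .prevote, endorsed := true }
        {⟨p, s.height, s.round,
          .prevote (some v) (some (endorsedTx P p s.height s.round v)) true⟩}
  /-- A new proposal is rejected. -/
  | rejectNew (s v rr) (hphase : s.phase = .propose)
      (hprop : HasProposal P s.log s.height s.round v (-1) rr) (href : ReferenceOK P s rr v)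
      (hbad : ¬ (P.valid s.height v ∧ (s.lockedRound = -1 ∨ s.lockedValue = some v))) :
      Rule P p now s { s with phase := .prevote }
        {⟨p, s.height, s.round, .prevote none none true⟩}
  /-- Endorsements are always broadcast, even if the node votes for another value or for `nil`, is
  locked, cannot verify the reference, or has left the prevote phase; but only once per round. -/
  | endorseOnly (s v rr) (hboot : s.phase ≠ .boot)
      (hprop : HasProposal P s.log s.height s.round v (-1) rr) (hvalid : P.valid s.height v)
      (hnot : ¬ (s.phase = .propose ∧ ReferenceOK P s rr v)) (hfirst : s.endorsed = false) :
      Rule P p now s { s with endorsed := true }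
        {⟨p, s.height, s.round,
          .prevote (some v) (some (endorsedTx P p s.height s.round v)) false⟩}
  /-- A proposal quorum-certified and properly endorsed before is approved. -/
  | approveOld (s v) (vr : ℕ) (rr) (hphase : s.phase = .propose)
      (hprop : HasProposal P s.log s.height s.round v vr rr) (hvr : vr < s.round)
      (hqc : P.quorum ≤ (prevoters s.log s.height vr (some v)).ncard)
      (hend : VerifyEndorsement P s.log s.height rr v)
      (hvalid : P.valid s.height v) (hlock : s.lockedRound ≤ (vr : ℤ) ∨ s.lockedValue = some v) :
      Rule P p now s { s with phase := .prevote }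
        {⟨p, s.height, s.round, .prevote (some v) none true⟩}
  | rejectOld (s v) (vr : ℕ) (rr) (hphase : s.phase = .propose)
      (hprop : HasProposal P s.log s.height s.round v vr rr) (hvr : vr < s.round)
      (hqc : P.quorum ≤ (prevoters s.log s.height vr (some v)).ncard)
      (hend : VerifyEndorsement P s.log s.height rr v)
      (hbad : ¬ (P.valid s.height v ∧ (s.lockedRound ≤ (vr : ℤ) ∨ s.lockedValue = some v))) :
      Rule P p now s { s with phase := .prevote }
        {⟨p, s.height, s.round, .prevote none none true⟩}
  | schedulePrevote (s) (hphase : s.phase = .prevote) (hfirst : s.tmrV = .off)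
      (hq : P.quorum ≤ (anyPrevoters s.log s.height s.round).ncard) :
      Rule P p now s { s with tmrV := .on (now + P.timeoutPrevote) } ∅
  /-- A quorum-certified and properly endorsed value is locked. -/
  | lock (s v vr rr) (hphase : s.phase = .prevote)
      (hprop : HasProposal P s.log s.height s.round v vr rr)
      (hqc : P.quorum ≤ (prevoters s.log s.height s.round (some v)).ncard)
      (hvalid : P.valid s.height v)
      (hend : VerifyEndorsement P s.log s.height rr v ∨
        VerifyEndorsement P s.log s.height s.round v) :
      Rule P p now s
        { s with lockedValue := some v, lockedRound := s.round, phase := .precommit }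
        {⟨p, s.height, s.round, .precommit (some v) ∅⟩}
  | updateValid (s) (r : ℕ) (v vr rr newRef) (hprop : HasProposal P s.log s.height r v vr rr)
      (hqc : P.quorum ≤ (prevoters s.log s.height r (some v)).ncard)
      (hvalid : P.valid s.height v) (hnew : s.validRound < (r : ℤ))
      (href : (VerifyEndorsement P s.log s.height r v ∧ newRef = (r : ℤ)) ∨
        (¬ VerifyEndorsement P s.log s.height r v ∧
          VerifyEndorsement P s.log s.height rr v ∧ newRef = rr)) :
      Rule P p now s { s with validValue := some v, validRound := r, refRound := newRef } ∅
  | nilQuorum (s) (hphase : s.phase = .prevote)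
      (hq : P.quorum ≤ (prevoters s.log s.height s.round none).ncard) :
      Rule P p now s { s with phase := .precommit }
        {⟨p, s.height, s.round, .precommit none ∅⟩}
  | schedulePrecommit (s) (hboot : s.phase ≠ .boot) (hfirst : s.tmrC = .off)
      (hq : P.quorum ≤ (anyPrecommitters s.log s.height s.round).ncard) :
      Rule P p now s { s with tmrC := .on (now + P.timeoutPrecommit s.round) } ∅
  /-- A value is committed; the node passes to the next height. Messages of other heights in the
  log have no effect, so the log is kept. -/
  | decide (s) (r : ℕ) (v vr rr s' out) (hboot : s.phase ≠ .boot)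
      (hprop : HasProposal P s.log s.height r v vr rr)
      (hq : P.quorum ≤ (cleanPrecommitters s.log s.height r v).ncard)
      (hvalid : P.valid s.height v)
      (hs : StartRound P p now
        { s with
          decision := fun k => open Classical in if k = s.height then some v else s.decision k
          height := s.height + 1
          lockedValue := none, lockedRound := -1
          validValue := none, validRound := -1
          refValue := none, refRound := -1 } 0 s' out) :
      Rule P p now s s' out
  /-- Messages of a later round from `f+1` nodes make the node start that round. -/
  | skipRound (s) (r : ℕ) (s' out) (hboot : s.phase ≠ .boot) (hr : s.round < r)
      (hq : P.f + 1 ≤ (roundSenders s.log s.height r).ncard)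
      (hs : StartRound P p now s r s' out) :
      Rule P p now s s' out
  /-- The reference is updated to an examined value with fewer transactions. -/
  | updateRef (s) (r : ℕ) (v rr) (hprop : HasProposal P s.log s.height r v (-1) rr)
      (hq : P.quorum ≤ (precommitters s.log s.height r v).ncard)
      (hbetter : s.refRound = -1 ∨
        (s.validRound = -1 ∧ ∃ w, s.refValue = some w ∧ v.txs.length < w.txs.length)) :
      Rule P p now s { s with refRound := r, refValue := some v } ∅
  /-- Once a value of the current round is examined, the next round starts. If the examined value is
  a new proposal, the reference has been updated first. -/
  | nextRound (s v vr rr s' out) (hboot : s.phase ≠ .boot)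
      (hprop : HasProposal P s.log s.height s.round v vr rr)
      (hq : P.quorum ≤ (precommitters s.log s.height s.round v).ncard)
      (hupd : vr = -1 → ¬ (s.refRound = -1 ∨
        (s.validRound = -1 ∧ ∃ w, s.refValue = some w ∧ v.txs.length < w.txs.length)))
      (hs : StartRound P p now s (s.round + 1) s' out) :
      Rule P p now s s' out
  /-- Two differing proposals in the current round before the precommit phase. -/
  | conflict (s v vr rr v' vr' rr') (hphase : s.phase = .propose ∨ s.phase = .prevote)
      (hprop : HasProposal P s.log s.height s.round v vr rr)
      (hprop' : HasProposal P s.log s.height s.round v' vr' rr') (hne : v ≠ v') :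
      Rule P p now s { s with phase := .precommit }
        {⟨p, s.height, s.round, .precommit none ∅⟩}
  /-- Rapid removal: every transaction is properly endorsed or vetoed, and not all are endorsed. -/
  | rapid (s v rr) (hphase : s.phase = .prevote)
      (hprop : HasProposal P s.log s.height s.round v (-1) rr)
      (hqc : P.quorum ≤ (prevoters s.log s.height s.round (some v)).ncard)
      (hvalid : P.valid s.height v)
      (hall : ∀ tx ∈ v.txs, ProperlyEndorsed P s.log s.height s.round v tx ∨
        Vetoed P s.log s.height s.round v tx)
      (hsome : (excludedTx P s.log s.height s.round v).Nonempty) :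
      Rule P p now s { s with phase := .precommit }
        {⟨p, s.height, s.round,
          .precommit (some v) (excludedTx P s.log s.height s.round v)⟩}

/-- The handlers of expired timers. -/
inductive Expire {n : ℕ} {Tx Res : Type*} (P : Protocol n Tx Res) (p : Fin n) (now : ℝ) :
    NodeState n Tx Res → NodeState n Tx Res → Set (Msg n Tx Res) → Prop where
  | propose (s d) (ht : s.tmrP = .on d) (hd : d ≤ now) (hphase : s.phase = .propose) :
      Expire P p now s { s with tmrP := .expired, phase := .prevote }
        {⟨p, s.height, s.round, .prevote none none true⟩}
  | proposeLate (s d) (ht : s.tmrP = .on d) (hd : d ≤ now) (hphase : s.phase ≠ .propose) :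
      Expire P p now s { s with tmrP := .expired } ∅
  /-- A new proposal is quorum-certified: precommit it, suggesting the removal of the transactions
  that lack endorsements. -/
  | prevoteValue (s d v rr) (ht : s.tmrV = .on d) (hd : d ≤ now) (hphase : s.phase = .prevote)
      (hprop : HasProposal P s.log s.height s.round v (-1) rr)
      (hqc : P.quorum ≤ (prevoters s.log s.height s.round (some v)).ncard) :
      Expire P p now s { s with tmrV := .expired, phase := .precommit }
        {⟨p, s.height, s.round,
          .precommit (some v) (excludedTx P s.log s.height s.round v)⟩}
  | prevoteNil (s d) (ht : s.tmrV = .on d) (hd : d ≤ now) (hphase : s.phase = .prevote)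
      (hno : ¬ ∃ v rr, HasProposal P s.log s.height s.round v (-1) rr ∧
        P.quorum ≤ (prevoters s.log s.height s.round (some v)).ncard) :
      Expire P p now s { s with tmrV := .expired, phase := .precommit }
        {⟨p, s.height, s.round, .precommit none ∅⟩}
  | prevoteLate (s d) (ht : s.tmrV = .on d) (hd : d ≤ now) (hphase : s.phase ≠ .prevote) :
      Expire P p now s { s with tmrV := .expired } ∅
  | precommit (s d s' out) (ht : s.tmrC = .on d) (hd : d ≤ now)
      (hs : StartRound P p now s (s.round + 1) s' out) :
      Expire P p now s s' out

/-- No rule is enabled. -/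
def Quiescent {n : ℕ} {Tx Res : Type*} (P : Protocol n Tx Res) (p : Fin n) (now : ℝ)
    (s : NodeState n Tx Res) : Prop :=
  ∀ s' out, ¬ Rule P p now s s' out

/-! ## Runs of the system in an eventually synchronous network -/

/-- A global state. `sent` and `received` record, with times, the messages that correct nodes have
broadcast and those that some correct node has received. The entries of `node` at faulty nodes have
no meaning. -/
structure GlobalState (n : ℕ) (Tx Res : Type*) where
  now : ℝ
  node : Fin n → NodeState n Tx Res
  sent : Set (ℝ × Msg n Tx Res)
  received : Set (ℝ × Msg n Tx Res)

def GlobalState.init (n : ℕ) (Tx Res : Type*) : GlobalState n Tx Res where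
  now := 0
  node := fun _ => NodeState.init n Tx Res
  sent := ∅
  received := ∅

open Classical in
/-- Node `p` passes to state `s'` and broadcasts the messages in `out`. -/
noncomputable def GlobalState.act {n : ℕ} {Tx Res : Type*} (S : GlobalState n Tx Res) (p : Fin n)
    (s' : NodeState n Tx Res) (out : Set (Msg n Tx Res)) : GlobalState n Tx Res :=
  { S with
    node := Function.update S.node p s'
    sent := S.sent ∪ {x | x.1 = S.now ∧ x.2 ∈ out} }

open Classical in
/-- Node `p` receives `m`. -/
noncomputable def GlobalState.deliver {n : ℕ} {Tx Res : Type*} (S : GlobalState n Tx Res)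
    (p : Fin n) (m : Msg n Tx Res) : GlobalState n Tx Res :=
  { S with
    node := Function.update S.node p { S.node p with log := insert m (S.node p).log }
    received := insert (S.now, m) S.received }

/-- The steps of the system with the given set of faulty nodes. Local computation takes no time:
a correct node applies its enabled rules, in any order, before it handles the next message or
timer and before time passes. Messages of correct nodes cannot be forged; faulty nodes may send
anything to anyone at any time. -/
inductive Step {n : ℕ} {Tx Res : Type*} (P : Protocol n Tx Res) (faulty : Set (Fin n)) (GST : ℝ) :
    GlobalState n Tx Res → GlobalState n Tx Res → Prop where
  | rule (S p s' out) (hp : p ∉ faulty) (hr : Rule P p S.now (S.node p) s' out) :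
      Step P faulty GST S (S.act p s' out)
  | timeout (S p s' out) (hp : p ∉ faulty) (hq : Quiescent P p S.now (S.node p))
      (he : Expire P p S.now (S.node p) s' out) :
      Step P faulty GST S (S.act p s' out)
  | deliver (S p m) (hp : p ∉ faulty) (hq : Quiescent P p S.now (S.node p))
      (hauth : m.sender ∈ faulty ∨ ∃ t, (t, m) ∈ S.sent) :
      Step P faulty GST S (S.deliver p m)
  /-- Time passes. No running timer is overrun, and a message that a correct node sent or received
  at time `t` reaches every correct node before `max t GST + Δ`. -/
  | tick (S) (t' : ℝ) (hle : S.now ≤ t')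
      (hq : ∀ p, p ∉ faulty → Quiescent P p S.now (S.node p))
      (htimer : ∀ p, p ∉ faulty → ∀ d, (S.node p).tmrP = .on d ∨ (S.node p).tmrV = .on d ∨
        (S.node p).tmrC = .on d → t' ≤ d)
      (hnet : ∀ t m, (t, m) ∈ S.sent ∪ S.received → ∀ p, p ∉ faulty → m ∉ (S.node p).log →
        t' < max t GST + P.Δ) :
      Step P faulty GST S { S with now := t' }

/-- A run; it may stutter, so that finite runs are included. -/
def IsRun {n : ℕ} {Tx Res : Type*} (P : Protocol n Tx Res) (faulty : Set (Fin n)) (GST : ℝ)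
    (run : ℕ → GlobalState n Tx Res) : Prop :=
  run 0 = GlobalState.init n Tx Res ∧
  ∀ k, Step P faulty GST (run k) (run (k + 1)) ∨ run (k + 1) = run k

/-- Round `r` of height `h` takes place after GST: no correct node sends a prevote of that round
before GST. -/
def AfterGST {n : ℕ} {Tx Res : Type*} (GST : ℝ) (run : ℕ → GlobalState n Tx Res)
    (h r : ℕ) : Prop :=
  ∀ k t i v D c, (t, (⟨i, h, r, .prevote v D c⟩ : Msg n Tx Res)) ∈ (run k).sent → GST ≤ t

/-- The correct nodes that endorse `tx` in `v` suffice for the policy of `tx`. -/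
def EnoughEndorse {n : ℕ} {Tx Res : Type*} (P : Protocol n Tx Res) (faulty : Set (Fin n))
    (h r : ℕ) (v : Block Tx Res) (tx : Tx) : Prop :=
  P.policy h v tx {p | p ∉ faulty ∧ tx ∈ P.endorse p h r v}

/-- At no time does a correct node hold prevotes of round `r` that allow `tx` to be rapidly removed
from `v`. -/
def NotRapidlyRemovable {n : ℕ} {Tx Res : Type*} (P : Protocol n Tx Res) (faulty : Set (Fin n))
    (run : ℕ → GlobalState n Tx Res) (h r : ℕ) (v : Block Tx Res) (tx : Tx) : Prop :=
  ∀ k p, p ∉ faulty → ¬ Vetoed P ((run k).node p).log h r v tx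

/-- Up to step `k`, the correct node `p` has suggested removing `tx` from `v` in round `r`. -/
def SuggestsRemoval {n : ℕ} {Tx Res : Type*} (run : ℕ → GlobalState n Tx Res) (k : ℕ)
    (p : Fin n) (h r : ℕ) (v : Block Tx Res) (tx : Tx) : Prop :=
  ∃ t R, (t, (⟨p, h, r, .precommit (some v) R⟩ : Msg n Tx Res)) ∈ (run k).sent ∧ tx ∈ R

end FlexTender

namespace FlexTender

/-! ## Monotonicity in the set of received messages -/

/-! A correct node suggests removals in only two ways. Rapid removal is ruled out at once: an
excluded transaction is not properly endorsed, so the rule would require it to be vetoed. The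
substance is the expiry of the prevote timer of a node `p`. The claim there
(`Waiting.properlyEndorsed`) is that `p` has by then received the endorsements of all correct nodes
that endorse `tx`; monotonicity of the policy does the rest.

The duration `2Δ` pays for two message delays. Let `k₀` be the first step at which some correct node
holds a quorum of votes of any kind. No prevote timer of the round starts earlier, so that of `p`
expires at least `2Δ` after `k₀` (`IsRun.prevote_deadline`). The quorum at `k₀` meets the quorum of
`p` for `v` in a correct node, which already had a new proposal of `v` (`Waiting.exists_voter`). One
delay spreads this proposal and the votes, which bring every correct node to round `r` and make it
broadcast its endorsements; the second delay brings these to `p`.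

Two things could spoil this: a correct node has left the round by then, or has endorsed another
proposal. Both are refuted by looking at `p`, which still sits in the prevote phase with no rule
enabled although it has received all that correct nodes knew during the first delay. A commit
certificate would have moved `p` to the next height, two proposals would have made it precommit
`nil`, and a properly endorsed value would have been locked. Rapid removal at another node is
impossible because `tx` is not vetoed and, arguing by contradiction, not properly endorsed at `p`.
So no correct node precommits during the first delay (`Waiting.precommit_not_sent`), and without a
correct precommit none gets past the round (`Waiting.round_le`). -/

theorem ncard_le_of_subset {n : ℕ} {A B : Set (Fin n)} (hAB : A ⊆ B) {q : ℕ}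
    (hq : q ≤ A.ncard) : q ≤ B.ncard :=
  hq.trans (Set.ncard_le_ncard hAB (Set.toFinite B))

theorem cleanPrecommitters_mono {n : ℕ} {Tx Res : Type*} {L L' : Set (Msg n Tx Res)}
    (hL : L ⊆ L') (h r : ℕ) (v : Block Tx Res) :
    cleanPrecommitters L h r v ⊆ cleanPrecommitters L' h r v :=
  fun _ hi => hL hi

theorem anyPrecommitters_mono {n : ℕ} {Tx Res : Type*} {L L' : Set (Msg n Tx Res)}
    (hL : L ⊆ L') (h r : ℕ) : anyPrecommitters L h r ⊆ anyPrecommitters L' h r :=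
  fun _ ⟨v, R, hR⟩ => ⟨v, R, hL hR⟩

theorem endorsers_mono {n : ℕ} {Tx Res : Type*} {L L' : Set (Msg n Tx Res)} (hL : L ⊆ L')
    (h r : ℕ) (v : Block Tx Res) (tx : Tx) : endorsers L h r v tx ⊆ endorsers L' h r v tx := by
  rintro i (⟨D, c, hD, htx⟩ | ⟨D, c, D', c', hD, hD', hne⟩)
  · exact Or.inl ⟨D, c, hL hD, htx⟩
  · exact Or.inr ⟨D, c, D', c', hL hD, hL hD', hne⟩

theorem ProperlyEndorsed.mono {n : ℕ} {Tx Res : Type*} {P : Protocol n Tx Res}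
    {L L' : Set (Msg n Tx Res)} {h r : ℕ} {v : Block Tx Res} {tx : Tx} (hL : L ⊆ L')
    (H : ProperlyEndorsed P L h r v tx) : ProperlyEndorsed P L' h r v tx :=
  P.policy_mono _ _ _ _ _ (endorsers_mono hL h r v tx) H

theorem VerifyEndorsement.mono {n : ℕ} {Tx Res : Type*} {P : Protocol n Tx Res}
    {L L' : Set (Msg n Tx Res)} {h : ℕ} {rr : ℤ} {v : Block Tx Res} (hL : L ⊆ L')
    (H : VerifyEndorsement P L h rr v) : VerifyEndorsement P L' h rr v := by
  obtain ⟨r, hr, H⟩ := H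
  exact ⟨r, hr, fun tx htx => (H tx htx).mono hL⟩

/-! ## Quorums -/

theorem exists_correct_of_ncard {n f : ℕ} {faulty A : Set (Fin n)} (hfaulty : faulty.ncard ≤ f)
    (hA : f + 1 ≤ A.ncard) : ∃ i ∈ A, i ∉ faulty := by
  by_contra! hc
  have := Set.ncard_le_ncard (s := A) (t := faulty) hc (Set.toFinite _)
  omega

theorem Protocol.succ_le_quorum {n : ℕ} {Tx Res : Type*} (P : Protocol n Tx Res)
    (hn : 3 * P.f + 1 ≤ n) : P.f + 1 ≤ P.quorum := by
  unfold Protocol.quorum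
  omega

/-- Twice the quorum size is at least `n + f + 1`, so two quorums share at least `f + 1` nodes, one
of them correct. -/
theorem exists_correct_of_quorums {n : ℕ} {Tx Res : Type*} {P : Protocol n Tx Res}
    {faulty A B : Set (Fin n)} (hfaulty : faulty.ncard ≤ P.f)
    (hA : P.quorum ≤ A.ncard) (hB : P.quorum ≤ B.ncard) : ∃ i, i ∈ A ∧ i ∈ B ∧ i ∉ faulty := by
  have h1 := Set.ncard_union_add_ncard_inter A B (Set.toFinite _) (Set.toFinite _)
  have h2 : (A ∪ B).ncard ≤ n := by
    simpa using Set.ncard_le_ncard (Set.subset_univ (A ∪ B)) (Set.toFinite _)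
  unfold Protocol.quorum at hA hB
  obtain ⟨i, hi, hif⟩ := exists_correct_of_ncard (A := A ∩ B) hfaulty (by omega)
  exact ⟨i, hi.1, hi.2, hif⟩

/-! ## Starting a round is always possible -/

theorem exists_first {α : Type*} (q : α → Prop) (l : List α) :
    (∃ l₁ a l₂, l = l₁ ++ a :: l₂ ∧ (∀ b ∈ l₁, ¬ q b) ∧ q a) ∨ ∀ b ∈ l, ¬ q b := by
  induction l with
  | nil => simp
  | cons x l ih =>
    by_cases hx : q x
    · exact Or.inl ⟨[], x, l, rfl, by simp, hx⟩
    · rcases ih with ⟨l₁, a, l₂, rfl, h₁, ha⟩ | ih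
      · refine Or.inl ⟨x :: l₁, a, l₂, rfl, ?_, ha⟩
        simpa [hx] using h₁
      · exact Or.inr (by simpa [hx] using ih)

theorem exists_extract {n : ℕ} {Tx Res : Type*} (P : Protocol n Tx Res)
    (L : Set (Msg n Tx Res)) (h : ℕ) (rr : ℤ) (v : Block Tx Res) : ∃ w, Extract P L h rr v w := by
  rcases exists_first (fun tx => ∃ r : ℕ, rr = r ∧ P.f + 1 ≤ (removers L h r v tx).ncard) v.txs
    with ⟨l₁, a, l₂, hv, h₁, ha⟩ | hno
  · exact ⟨_, Or.inl ⟨l₁, a, l₂, hv, h₁, ha, rfl⟩⟩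
  · exact ⟨v, Or.inr ⟨hno, rfl⟩⟩

/-- Quiescence can refute the premises of a round-changing rule only if that rule has an outcome.
The block `v` serves as the fresh proposal of a proposer with neither a valid nor a reference value.
-/
theorem exists_startRound {n : ℕ} {Tx Res : Type*} (P : Protocol n Tx Res) (p : Fin n) (now : ℝ)
    (s : NodeState n Tx Res) (r : ℕ) (v : Block Tx Res) :
    ∃ s' out, StartRound P p now s r s' out := by
  have hv : ∃ v, NextValue P s v := by
    unfold NextValue
    split
    · exact ⟨_, rfl⟩
    · exact exists_extract ..
    · exact ⟨v, trivial⟩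
  obtain ⟨w, hw⟩ := hv
  by_cases hp : P.proposer s.height r = p
  · exact ⟨_, _, rfl, by rw [if_pos hp]; exact ⟨w, hw, rfl⟩⟩
  · exact ⟨_, _, rfl, by rw [if_neg hp]⟩

/-! ## Local steps -/

/-- What a node needs to have received in order to decide height `h`. -/
def Decided {n : ℕ} {Tx Res : Type*} (P : Protocol n Tx Res) (L : Set (Msg n Tx Res))
    (h : ℕ) : Prop :=
  ∃ r v vr rr, HasProposal P L h r v vr rr ∧ P.quorum ≤ (cleanPrecommitters L h r v).ncard ∧
    P.valid h v

theorem Decided.mono {n : ℕ} {Tx Res : Type*} {P : Protocol n Tx Res}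
    {L L' : Set (Msg n Tx Res)} {h : ℕ} (hL : L ⊆ L') (H : Decided P L h) : Decided P L' h := by
  obtain ⟨r, v, vr, rr, hprop, hq, hvalid⟩ := H
  exact ⟨r, v, vr, rr, hL hprop, ncard_le_of_subset (cleanPrecommitters_mono hL h r v) hq, hvalid⟩

/-- The messages `X` of node `p` contain endorsements for a proposal of the given round. -/
def HasEndorsed {n : ℕ} {Tx Res : Type*} (P : Protocol n Tx Res) (p : Fin n)
    (L X : Set (Msg n Tx Res)) (h r : ℕ) : Prop :=
  ∃ v rr c, HasProposal P L h r v (-1) rr ∧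
    ⟨p, h, r, .prevote (some v) (some (endorsedTx P p h r v)) c⟩ ∈ X

theorem HasEndorsed.mono {n : ℕ} {Tx Res : Type*} {P : Protocol n Tx Res} {p : Fin n}
    {L L' X X' : Set (Msg n Tx Res)} {h r : ℕ} (hL : L ⊆ L') (hX : X ⊆ X')
    (H : HasEndorsed P p L X h r) : HasEndorsed P p L' X' h r := by
  obtain ⟨v, rr, c, hprop, hm⟩ := H
  exact ⟨v, rr, c, hL hprop, hX hm⟩

/-- A node executes a rule or handles an expired timer. -/
def Action {n : ℕ} {Tx Res : Type*} (P : Protocol n Tx Res) (p : Fin n) (now : ℝ)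
    (s s' : NodeState n Tx Res) (out : Set (Msg n Tx Res)) : Prop :=
  Rule P p now s s' out ∨ Expire P p now s s' out

/-- The common features of all actions: a new round starts, or the round stays the same. -/
inductive Effect {n : ℕ} {Tx Res : Type*} (P : Protocol n Tx Res) (p : Fin n) (now : ℝ)
    (s s' : NodeState n Tx Res) (out : Set (Msg n Tx Res)) : Prop where
  | advance (log : s'.log = s.log) (phase : s'.phase = .propose) (endorsed : s'.endorsed = false)
      (tmrV : s'.tmrV = .off) (tmrC : s'.tmrC = .off)
      (msgs : ∀ m ∈ out, ∃ v vr rr, m = ⟨p, s'.height, s'.round, .proposal v vr rr⟩)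
      (pos : (s.phase = .boot ∧ s'.height = s.height ∧ s'.round = 0) ∨
        (s'.height = s.height ∧ s.round < s'.round) ∨
        (s'.height = s.height + 1 ∧ s'.round = 0 ∧ Decided P s.log s.height)) :
      Effect P p now s s' out
  | stay (log : s'.log = s.log) (height : s'.height = s.height) (round : s'.round = s.round)
      (phase : s'.phase = s.phase ∨ s'.phase = .prevote ∨ s'.phase = .precommit)
      (msgs : ∀ m ∈ out, ∃ b, m = ⟨p, s.height, s.round, b⟩)
      (vote : (∀ m ∈ out, ∀ v D, m.body ≠ .prevote v D true) ∨
        (s.phase = .propose ∧ s'.phase = .prevote ∧ ∃ m, out = {m}))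
      (endorsed : s'.endorsed = s.endorsed ∨ HasEndorsed P p s.log out s.height s.round)
      (tmrV : s'.tmrV = s.tmrV ∨ s'.tmrV = .expired ∨
        (s'.tmrV = .on (now + 2 * P.Δ) ∧
          P.quorum ≤ (anyPrevoters s.log s.height s.round).ncard))
      (tmrC : s'.tmrC = s.tmrC ∨ P.quorum ≤ (anyPrecommitters s.log s.height s.round).ncard) :
      Effect P p now s s' out

theorem StartRound.eq_proposal {n : ℕ} {Tx Res : Type*} {P : Protocol n Tx Res} {p : Fin n}
    {now : ℝ} {s s' : NodeState n Tx Res} {out : Set (Msg n Tx Res)} {r : ℕ}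
    (hs : StartRound P p now s r s' out) :
    ∀ m ∈ out, ∃ v vr rr, m = ⟨p, s.height, r, .proposal v vr rr⟩ := by
  obtain ⟨-, hout⟩ := hs
  intro m hm
  split_ifs at hout with hp
  · obtain ⟨v, -, rfl⟩ := hout
    exact ⟨v, _, _, hm⟩
  · simp [hout] at hm

theorem StartRound.effect {n : ℕ} {Tx Res : Type*} {P : Protocol n Tx Res} {p : Fin n} {now : ℝ}
    {s₀ s s' : NodeState n Tx Res} {out : Set (Msg n Tx Res)} {r : ℕ}
    (hs : StartRound P p now s r s' out) (hlog : s.log = s₀.log)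
    (pos : (s₀.phase = .boot ∧ s.height = s₀.height ∧ r = 0) ∨
        (s.height = s₀.height ∧ s₀.round < r) ∨
        (s.height = s₀.height + 1 ∧ r = 0 ∧ Decided P s₀.log s₀.height)) :
    Effect P p now s₀ s' out := by
  have hout := hs.eq_proposal
  obtain ⟨rfl, -⟩ := hs
  exact .advance hlog rfl rfl rfl rfl hout pos

/-- The one pass over all rules and timers that the invariants need; afterwards they distinguish
only the two cases of `Effect`. -/
theorem Action.effect {n : ℕ} {Tx Res : Type*} {P : Protocol n Tx Res} {p : Fin n} {now : ℝ}
    {s s' : NodeState n Tx Res} {out : Set (Msg n Tx Res)} (ha : Action P p now s s' out) :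
    Effect P p now s s' out := by
  rcases ha with ha | ha
  · cases ha with
    | start s' out hphase hs => exact hs.effect rfl (Or.inl ⟨hphase, rfl, rfl⟩)
    | approveNew v rr hphase hprop href hvalid hlock =>
      exact .stay rfl rfl rfl (by simp) (by simp) (Or.inr ⟨hphase, rfl, _, rfl⟩)
        (Or.inr ⟨v, rr, true, hprop, rfl⟩) (Or.inl rfl) (Or.inl rfl)
    | rejectNew v rr hphase =>
      exact .stay rfl rfl rfl (by simp) (by simp) (Or.inr ⟨hphase, rfl, _, rfl⟩)
        (Or.inl rfl) (Or.inl rfl) (Or.inl rfl)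
    | endorseOnly v rr hboot hprop =>
      exact .stay rfl rfl rfl (by simp) (by simp) (Or.inl (by simp))
        (Or.inr ⟨v, rr, false, hprop, rfl⟩) (Or.inl rfl) (Or.inl rfl)
    | approveOld v vr rr hphase =>
      exact .stay rfl rfl rfl (by simp) (by simp) (Or.inr ⟨hphase, rfl, _, rfl⟩)
        (Or.inl rfl) (Or.inl rfl) (Or.inl rfl)
    | rejectOld v vr rr hphase =>
      exact .stay rfl rfl rfl (by simp) (by simp) (Or.inr ⟨hphase, rfl, _, rfl⟩)
        (Or.inl rfl) (Or.inl rfl) (Or.inl rfl)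
    | schedulePrevote hphase hfirst hq =>
      exact .stay rfl rfl rfl (by simp) (by simp) (Or.inl (by simp))
        (Or.inl rfl) (Or.inr (Or.inr ⟨rfl, hq⟩)) (Or.inl rfl)
    | schedulePrecommit hboot hfirst hq =>
      exact .stay rfl rfl rfl (by simp) (by simp) (Or.inl (by simp))
        (Or.inl rfl) (Or.inl rfl) (Or.inr hq)
    | decide r v vr rr s' out hboot hprop hq hvalid hs =>
      exact hs.effect rfl (Or.inr (Or.inr ⟨rfl, rfl, r, v, vr, rr, hprop, hq, hvalid⟩))
    | skipRound r s' out hboot hr hq hs => exact hs.effect rfl (Or.inr (Or.inl ⟨rfl, hr⟩))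
    | nextRound v vr rr s' out hboot hprop hq hupd hs =>
      exact hs.effect rfl (Or.inr (Or.inl ⟨rfl, Nat.lt_succ_self _⟩))
    | _ =>
      exact .stay rfl rfl rfl (by simp) (by simp) (Or.inl (by simp))
        (Or.inl rfl) (Or.inl rfl) (Or.inl rfl)
  · cases ha with
    | propose d ht hd hphase =>
      exact .stay rfl rfl rfl (by simp) (by simp) (Or.inr ⟨hphase, rfl, _, rfl⟩)
        (Or.inl rfl) (Or.inl rfl) (Or.inl rfl)
    | proposeLate =>
      exact .stay rfl rfl rfl (by simp) (by simp) (Or.inl (by simp))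
        (Or.inl rfl) (Or.inl rfl) (Or.inl rfl)
    | precommit d s' out ht hd hs => exact hs.effect rfl (Or.inr (Or.inl ⟨rfl, Nat.lt_succ_self _⟩))
    | _ =>
      exact .stay rfl rfl rfl (by simp) (by simp) (Or.inl (by simp))
        (Or.inl rfl) (Or.inr (Or.inl rfl)) (Or.inl rfl)

theorem Action.log_eq {n : ℕ} {Tx Res : Type*} {P : Protocol n Tx Res} {p : Fin n} {now : ℝ}
    {s s' : NodeState n Tx Res} {out : Set (Msg n Tx Res)} (ha : Action P p now s s' out) :
    s'.log = s.log := by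
  cases ha.effect <;> assumption

theorem Action.sender_eq {n : ℕ} {Tx Res : Type*} {P : Protocol n Tx Res} {p : Fin n} {now : ℝ}
    {s s' : NodeState n Tx Res} {out : Set (Msg n Tx Res)} (ha : Action P p now s s' out) :
    ∀ m ∈ out, m.sender = p := by
  intro m hm
  cases ha.effect with
  | advance _ _ _ _ _ hout =>
    obtain ⟨v, vr, rr, rfl⟩ := hout m hm
    rfl
  | stay _ _ _ _ hout =>
    obtain ⟨b, rfl⟩ := hout m hm
    rfl

/-! ### Invariants of a single correct node -/

/-- The invariant of a correct node `p` in state `s` that has broadcast the messages in `X`. -/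
structure LocalInv {n : ℕ} {Tx Res : Type*} (P : Protocol n Tx Res) (p : Fin n)
    (s : NodeState n Tx Res) (X : Set (Msg n Tx Res)) : Prop where
  boot : s.phase = .boot → s.round = 0
  pos : ∀ m ∈ X, m.height < s.height ∨ (m.height = s.height ∧ m.round ≤ s.round)
  voted : ∀ v D, ⟨p, s.height, s.round, .prevote v D true⟩ ∈ X →
    s.phase = .prevote ∨ s.phase = .precommit
  unique : ∀ h r v D v' D', ⟨p, h, r, .prevote v D true⟩ ∈ X →
    ⟨p, h, r, .prevote v' D' true⟩ ∈ X → v = v'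
  endorsed : s.endorsed = true → HasEndorsed P p s.log X s.height s.round
  decided : ∀ h < s.height, Decided P s.log h
  precommits : ∀ d, s.tmrC = .on d → P.quorum ≤ (anyPrecommitters s.log s.height s.round).ncard

theorem LocalInv.init {n : ℕ} {Tx Res : Type*} (P : Protocol n Tx Res) (p : Fin n) :
    LocalInv P p (NodeState.init n Tx Res) ∅ := by
  constructor <;> simp [NodeState.init]

theorem LocalInv.deliver {n : ℕ} {Tx Res : Type*} {P : Protocol n Tx Res} {p : Fin n}
    {s : NodeState n Tx Res} {X : Set (Msg n Tx Res)} (H : LocalInv P p s X) (m : Msg n Tx Res) :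
    LocalInv P p { s with log := insert m s.log } X where
  boot := H.boot
  pos := H.pos
  voted := H.voted
  unique := H.unique
  endorsed he := (H.endorsed he).mono (Set.subset_insert _ _) subset_rfl
  decided h hh := (H.decided h hh).mono (Set.subset_insert _ _)
  precommits d hd :=
    ncard_le_of_subset (anyPrecommitters_mono (Set.subset_insert _ _) _ _) (H.precommits d hd)

/-- A consensus vote is cast only in the propose phase and ends it, and within a round no action
leads back; hence one vote per round. A new round starts beyond the position of every message sent
so far, so no vote for it exists yet. -/
theorem LocalInv.action {n : ℕ} {Tx Res : Type*} {P : Protocol n Tx Res} {p : Fin n} {now : ℝ}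
    {s s' : NodeState n Tx Res} {X out : Set (Msg n Tx Res)} (H : LocalInv P p s X)
    (ha : Action P p now s s' out) : LocalInv P p s' (X ∪ out) := by
  cases ha.effect with
  | advance hlog hphase hendorsed hV hC hout hpos =>
    have hnv : ∀ h r v D, (⟨p, h, r, .prevote v D true⟩ : Msg n Tx Res) ∉ out := by
      intro h r v D hm
      obtain ⟨_, _, _, heq⟩ := hout _ hm
      simp at heq
    refine ⟨by simp [hphase], ?_, ?_, ?_, by simp [hendorsed], ?_, by simp [hC]⟩
    · rintro m (hm | hm)
      · have h1 := H.pos m hm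
        have h2 := H.boot
        rcases hpos with ⟨hb, h3, h4⟩ | ⟨h3, h4⟩ | ⟨h3, h4, -⟩
        · have := h2 hb
          omega
        · omega
        · omega
      · obtain ⟨_, _, _, rfl⟩ := hout _ hm
        simp
    · rintro v D (hm | hm)
      · exfalso
        rcases hpos with ⟨hb, h3, h4⟩ | ⟨h3, h4⟩ | ⟨h3, h4, -⟩
        -- Leaving the boot phase keeps the position, but no vote can have been cast while booting.
        · rw [h3, h4, ← H.boot hb] at hm
          simpa [hb] using H.voted _ _ hm
        · have := H.pos _ hm
          simp only at this
          omega
        · have := H.pos _ hm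
          simp only at this
          omega
      · exact absurd hm (hnv _ _ _ _)
    · rintro h r v D v' D' (hm | hm) (hm' | hm')
      · exact H.unique _ _ _ _ _ _ hm hm'
      all_goals first
        | exact absurd hm (hnv _ _ _ _)
        | exact absurd hm' (hnv _ _ _ _)
    · intro h hh
      rw [hlog]
      rcases hpos with ⟨hb, h3, h4⟩ | ⟨h3, h4⟩ | ⟨h3, h4, h5⟩
      · exact H.decided h (h3 ▸ hh)
      · exact H.decided h (h3 ▸ hh)
      · rcases (show h < s.height ∨ h = s.height by omega) with hlt | rfl
        · exact H.decided h hlt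
        · exact h5
  | stay hlog hheight hround hphase hout hvote hendorsed hV hC =>
    refine ⟨?_, ?_, ?_, ?_, ?_, ?_, ?_⟩
    · intro hb
      rw [hround]
      rw [hb] at hphase
      exact H.boot (by simpa using hphase : Phase.boot = s.phase).symm
    · rintro m (hm | hm)
      · rw [hheight, hround]
        exact H.pos m hm
      · obtain ⟨b, rfl⟩ := hout _ hm
        simp [hheight, hround]
    · rintro v D (hm | hm)
      · rw [hheight, hround] at hm
        rcases hphase with hp | hp
        · rw [hp]
          exact H.voted _ _ hm
        · exact hp
      · rcases hvote with hno | ⟨-, hp, -⟩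
        · exact absurd rfl (hno _ hm v D)
        · exact Or.inl hp
    · have hfresh : ∀ h r v D v' D', (⟨p, h, r, .prevote v D true⟩ : Msg n Tx Res) ∈ out →
          (⟨p, h, r, .prevote v' D' true⟩ : Msg n Tx Res) ∉ X := by
        intro h r v D v' D' hm hm'
        rcases hvote with hno | ⟨hp, -, -⟩
        · exact absurd rfl (hno _ hm v D)
        · obtain ⟨b, heq⟩ := hout _ hm
          simp only [Msg.mk.injEq] at heq
          obtain ⟨-, rfl, rfl, -⟩ := heq
          simpa [hp] using H.voted _ _ hm'
      rintro h r v D v' D' (hm | hm) (hm' | hm')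
      · exact H.unique _ _ _ _ _ _ hm hm'
      · exact absurd hm (hfresh _ _ _ _ _ _ hm')
      · exact absurd hm' (hfresh _ _ _ _ _ _ hm)
      · rcases hvote with hno | ⟨-, -, m, rfl⟩
        · exact absurd rfl (hno _ hm v D)
        · have := hm.trans hm'.symm
          simp only [Msg.mk.injEq, Body.prevote.injEq] at this
          exact this.2.2.2.1
    · intro he
      rw [hlog, hheight, hround]
      rcases hendorsed with heq | hE
      · exact (H.endorsed (heq ▸ he)).mono subset_rfl Set.subset_union_left
      · exact hE.mono subset_rfl Set.subset_union_right
    · rw [hlog, hheight]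
      exact H.decided
    · intro d hd
      rw [hlog, hheight, hround]
      rcases hC with heq | hq
      · exact H.precommits d (heq ▸ hd)
      · exact hq

/-! ## Runs -/

section Run

variable {n : ℕ} {Tx Res : Type*} {P : Protocol n Tx Res} {faulty : Set (Fin n)} {GST : ℝ}
  {run : ℕ → GlobalState n Tx Res}

/-- The messages that `p` has broadcast. -/
def GlobalState.sentBy {n : ℕ} {Tx Res : Type*} (S : GlobalState n Tx Res) (p : Fin n) :
    Set (Msg n Tx Res) :=
  {m | m.sender = p ∧ ∃ t, (t, m) ∈ S.sent}

/-- The kinds of steps of a run, with rules and timers treated alike. -/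
inductive StepKind {n : ℕ} {Tx Res : Type*} (P : Protocol n Tx Res) (faulty : Set (Fin n))
    (GST : ℝ) (S S' : GlobalState n Tx Res) : Prop where
  | stutter (hS : S' = S)
  | action (p : Fin n) (s' : NodeState n Tx Res) (out : Set (Msg n Tx Res)) (hp : p ∉ faulty)
      (ha : Rule P p S.now (S.node p) s' out ∨
        (Quiescent P p S.now (S.node p) ∧ Expire P p S.now (S.node p) s' out))
      (hS : S' = S.act p s' out)
  | deliver (p : Fin n) (m : Msg n Tx Res) (hp : p ∉ faulty)
      (hauth : m.sender ∈ faulty ∨ ∃ t, (t, m) ∈ S.sent) (hS : S' = S.deliver p m)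
  | tick (t' : ℝ) (hle : S.now ≤ t')
      (hq : ∀ p, p ∉ faulty → Quiescent P p S.now (S.node p))
      (hnet : ∀ t m, (t, m) ∈ S.sent ∪ S.received → ∀ p, p ∉ faulty → m ∉ (S.node p).log →
        t' < max t GST + P.Δ)
      (hS : S' = { S with now := t' })

theorem IsRun.stepKind (hrun : IsRun P faulty GST run) (k : ℕ) :
    StepKind P faulty GST (run k) (run (k + 1)) := by
  rcases hrun.2 k with hstep | hstep
  · generalize run k = S at hstep
    generalize run (k + 1) = S' at hstep
    cases hstep with
    | rule p s' out hp hr => exact .action p s' out hp (Or.inl hr) rfl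
    | timeout p s' out hp hq he => exact .action p s' out hp (Or.inr ⟨hq, he⟩) rfl
    | deliver p m hp hq hauth => exact .deliver p m hp hauth rfl
    | tick t' hle hq htimer hnet => exact .tick t' hle hq hnet rfl
  · exact .stutter hstep

theorem action_of_step {p : Fin n} {now : ℝ} {s s' : NodeState n Tx Res}
    {out : Set (Msg n Tx Res)} (ha : Rule P p now s s' out ∨
      (Quiescent P p now s ∧ Expire P p now s s' out)) : Action P p now s s' out :=
  ha.imp id And.right

/-! ### Growth of time, messages and logs along a run -/

theorem IsRun.now_le_succ (hrun : IsRun P faulty GST run) (k : ℕ) :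
    (run k).now ≤ (run (k + 1)).now := by
  cases hrun.stepKind k with
  | stutter hS => rw [hS]
  | action p s' out hp ha hS => rw [hS]; exact le_rfl
  | deliver p m hp hauth hS => rw [hS]; exact le_rfl
  | tick t' hle hq hnet hS => rw [hS]; exact hle

theorem IsRun.now_mono (hrun : IsRun P faulty GST run) : Monotone fun k => (run k).now :=
  monotone_nat_of_le_succ hrun.now_le_succ

theorem IsRun.sent_mono (hrun : IsRun P faulty GST run) : Monotone fun k => (run k).sent := by
  refine monotone_nat_of_le_succ fun k => ?_
  cases hrun.stepKind k with
  | stutter hS => rw [hS]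
  | action p s' out hp ha hS => rw [hS]; exact Set.subset_union_left
  | deliver p m hp hauth hS => rw [hS]; exact le_rfl
  | tick t' hle hq hnet hS => rw [hS]

theorem IsRun.received_mono (hrun : IsRun P faulty GST run) :
    Monotone fun k => (run k).received := by
  refine monotone_nat_of_le_succ fun k => ?_
  cases hrun.stepKind k with
  | stutter hS => rw [hS]
  | action p s' out hp ha hS => rw [hS]; exact le_rfl
  | deliver p m hp hauth hS => rw [hS]; exact Set.subset_insert _ _
  | tick t' hle hq hnet hS => rw [hS]

theorem IsRun.log_mono (hrun : IsRun P faulty GST run) (q : Fin n) :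
    Monotone fun k => ((run k).node q).log := by
  refine monotone_nat_of_le_succ fun k => ?_
  cases hrun.stepKind k with
  | stutter hS => rw [hS]
  | action p s' out hp ha hS =>
    rw [hS]
    by_cases hqp : q = p
    · subst hqp
      simp [GlobalState.act, (action_of_step ha).log_eq]
    · simp [GlobalState.act, hqp]
  | deliver p m hp hauth hS =>
    rw [hS]
    by_cases hqp : q = p
    · subst hqp
      simp [GlobalState.deliver]
    · simp [GlobalState.deliver, hqp]
  | tick t' hle hq hnet hS => rw [hS]

theorem IsRun.localInv (hrun : IsRun P faulty GST run) (k : ℕ) (q : Fin n) :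
    LocalInv P q ((run k).node q) ((run k).sentBy q) := by
  induction k with
  | zero =>
    rw [hrun.1]
    simpa [GlobalState.init, GlobalState.sentBy] using LocalInv.init P q
  | succ k ih =>
    cases hrun.stepKind k with
    | stutter hS => rwa [hS]
    | action p s' out hp ha hS =>
      have ha' := action_of_step ha
      by_cases hqp : q = p
      · subst hqp
        have hX : (run (k + 1)).sentBy q = (run k).sentBy q ∪ out := by
          ext m
          simp only [hS, GlobalState.sentBy, GlobalState.act, Set.mem_union, Set.mem_ofPred_eq]
          constructor
          · rintro ⟨hm, t, ht | ⟨-, ht⟩⟩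
            · exact Or.inl ⟨hm, t, ht⟩
            · exact Or.inr ht
          · rintro (⟨hm, t, ht⟩ | hm)
            · exact ⟨hm, t, Or.inl ht⟩
            · exact ⟨ha'.sender_eq m hm, _, Or.inr ⟨rfl, hm⟩⟩
        rw [hX]
        simpa [hS, GlobalState.act] using ih.action ha'
      · have hX : (run (k + 1)).sentBy q = (run k).sentBy q := by
          ext m
          simp only [hS, GlobalState.sentBy, GlobalState.act, Set.mem_union, Set.mem_ofPred_eq]
          constructor
          · rintro ⟨hm, t, ht | ⟨-, ht⟩⟩
            · exact ⟨hm, t, ht⟩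
            · exact absurd (hm.symm.trans (ha'.sender_eq m ht)) hqp
          · rintro ⟨hm, t, ht⟩
            exact ⟨hm, t, Or.inl ht⟩
        rw [hX]
        simpa [hS, GlobalState.act, hqp] using ih
    | deliver p m hp hauth hS =>
      have hX : (run (k + 1)).sentBy q = (run k).sentBy q := by rw [hS]; rfl
      rw [hX]
      by_cases hqp : q = p
      · subst hqp
        simpa [hS, GlobalState.deliver] using ih.deliver m
      · simpa [hS, GlobalState.deliver, hqp] using ih
    | tick t' hle hq hnet hS =>
      rw [hS]
      exact ih

/-- Every broadcast message stems from an action of a correct node. -/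
theorem IsRun.exists_action_of_sent (hrun : IsRun P faulty GST run) {k : ℕ} {t : ℝ}
    {m : Msg n Tx Res} (hm : (t, m) ∈ (run k).sent) :
    ∃ j < k, ∃ p s' out, p ∉ faulty ∧ m ∈ out ∧ t = (run j).now ∧
      (Rule P p (run j).now ((run j).node p) s' out ∨
        (Quiescent P p (run j).now ((run j).node p) ∧
          Expire P p (run j).now ((run j).node p) s' out)) := by
  induction k with
  | zero => simp [hrun.1, GlobalState.init] at hm
  | succ k ih =>
    have lift (hm' : (t, m) ∈ (run k).sent) : ∃ j < k + 1, ∃ p s' out, p ∉ faulty ∧ m ∈ out ∧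
        t = (run j).now ∧ (Rule P p (run j).now ((run j).node p) s' out ∨
          (Quiescent P p (run j).now ((run j).node p) ∧
            Expire P p (run j).now ((run j).node p) s' out)) :=
      let ⟨j, hj, H⟩ := ih hm'
      ⟨j, hj.trans (Nat.lt_succ_self k), H⟩
    cases hrun.stepKind k with
    | stutter hS => exact lift (by rwa [hS] at hm)
    | action p s' out hp ha hS =>
      rw [hS] at hm
      rcases hm with hm | ⟨ht, hm⟩
      · exact lift hm
      · exact ⟨k, Nat.lt_succ_self k, p, s', out, hp, hm, ht, ha⟩
    | deliver p m' hp hauth hS => exact lift (by rwa [hS] at hm)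
    | tick t' hle hq hnet hS => exact lift (by rwa [hS] at hm)

/-- Messages of correct nodes cannot be forged. -/
theorem IsRun.sent_of_mem_log (hrun : IsRun P faulty GST run) {k : ℕ} {q : Fin n}
    {m : Msg n Tx Res} (hm : m ∈ ((run k).node q).log) (hs : m.sender ∉ faulty) :
    ∃ t, (t, m) ∈ (run k).sent := by
  induction k with
  | zero => simp [hrun.1, GlobalState.init, NodeState.init] at hm
  | succ k ih =>
    have lift (hm' : m ∈ ((run k).node q).log) : ∃ t, (t, m) ∈ (run (k + 1)).sent :=
      let ⟨t, ht⟩ := ih hm'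
      ⟨t, hrun.sent_mono (Nat.le_succ k) ht⟩
    cases hrun.stepKind k with
    | stutter hS => exact lift (by rwa [hS] at hm)
    | action p s' out hp ha hS =>
      refine lift ?_
      rw [hS] at hm
      by_cases hqp : q = p
      · subst hqp
        simpa [GlobalState.act, (action_of_step ha).log_eq] using hm
      · simpa [GlobalState.act, hqp] using hm
    | deliver p m' hp hauth hS =>
      rw [hS] at hm
      by_cases hqp : q = p
      · subst hqp
        simp only [GlobalState.deliver, Function.update_self, Set.mem_insert_iff] at hm
        rcases hm with rfl | hm
        · obtain ⟨t, ht⟩ := hauth.resolve_left hs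
          exact ⟨t, hrun.sent_mono (Nat.le_succ k) ht⟩
        · exact lift hm
      · exact lift (by simpa [GlobalState.deliver, hqp] using hm)
    | tick t' hle hq hnet hS => exact lift (by rwa [hS] at hm)

theorem IsRun.received_of_mem_log (hrun : IsRun P faulty GST run) {k : ℕ} {q : Fin n}
    {m : Msg n Tx Res} (hm : m ∈ ((run k).node q).log) :
    ∃ t ≤ (run k).now, (t, m) ∈ (run k).received := by
  induction k with
  | zero => simp [hrun.1, GlobalState.init, NodeState.init] at hm
  | succ k ih =>
    have lift (hm' : m ∈ ((run k).node q).log) :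
        ∃ t ≤ (run (k + 1)).now, (t, m) ∈ (run (k + 1)).received :=
      let ⟨t, htk, ht⟩ := ih hm'
      ⟨t, htk.trans (hrun.now_le_succ k), hrun.received_mono (Nat.le_succ k) ht⟩
    cases hrun.stepKind k with
    | stutter hS => exact lift (by rwa [hS] at hm)
    | action p s' out hp ha hS =>
      refine lift ?_
      rw [hS] at hm
      by_cases hqp : q = p
      · subst hqp
        simpa [GlobalState.act, (action_of_step ha).log_eq] using hm
      · simpa [GlobalState.act, hqp] using hm
    | deliver p m' hp hauth hS =>
      rw [hS] at hm
      by_cases hqp : q = p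
      · subst hqp
        simp only [GlobalState.deliver, Function.update_self, Set.mem_insert_iff] at hm
        rcases hm with rfl | hm
        · exact ⟨(run k).now, hrun.now_le_succ k, by rw [hS]; exact Set.mem_insert _ _⟩
        · exact lift hm
      · exact lift (by simpa [GlobalState.deliver, hqp] using hm)
    | tick t' hle hq hnet hS => exact lift (by rwa [hS] at hm)

/-! ### Delivery of messages after GST -/

/-- The bound on message delays. -/
theorem IsRun.now_lt_of_not_mem_log (hrun : IsRun P faulty GST run) {k : ℕ} {q : Fin n}
    {m : Msg n Tx Res} {t : ℝ} (hq : q ∉ faulty) (hm : (t, m) ∈ (run k).sent ∪ (run k).received)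
    (hlog : m ∉ ((run k).node q).log) : (run k).now < max t GST + P.Δ := by
  have hΔ := P.Δ_pos
  induction k with
  | zero => simp [hrun.1, GlobalState.init] at hm
  | succ k ih =>
    have hlog' : m ∉ ((run k).node q).log := fun hm' => hlog (hrun.log_mono q (Nat.le_succ k) hm')
    -- A message recorded at the present moment is within its delay because `Δ` is positive.
    have new : (run (k + 1)).now = t → (run (k + 1)).now < max t GST + P.Δ := fun ht => by
      have := le_max_left t GST
      linarith
    cases hrun.stepKind k with
    | stutter hS => exact hS ▸ ih (by rwa [hS] at hm) hlog'
    | action p s' out hp ha hS =>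
      have hnow : (run (k + 1)).now = (run k).now := by rw [hS]; rfl
      rw [hS] at hm
      rcases hm with (hm | hm) | hm
      · exact hnow ▸ ih (Or.inl hm) hlog'
      · exact new (hnow.trans hm.1.symm)
      · exact hnow ▸ ih (Or.inr hm) hlog'
    | deliver p m' hp hauth hS =>
      have hnow : (run (k + 1)).now = (run k).now := by rw [hS]; rfl
      rw [hS] at hm
      rcases hm with hm | hm | hm
      · exact hnow ▸ ih (Or.inl hm) hlog'
      · exact new (hnow.trans (congrArg Prod.fst hm).symm)
      · exact hnow ▸ ih (Or.inr hm) hlog'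
    | tick t' hle hq' hnet hS =>
      have hm' : (t, m) ∈ (run k).sent ∪ (run k).received := by rwa [hS] at hm
      rw [hS]
      exact hnet t m hm' q hq hlog'

theorem IsRun.time_le_of_sent (hrun : IsRun P faulty GST run) {k : ℕ} {t : ℝ}
    {m : Msg n Tx Res} (hm : (t, m) ∈ (run k).sent) : t ≤ (run k).now := by
  obtain ⟨j, hj, -, -, -, -, -, rfl, -⟩ := hrun.exists_action_of_sent hm
  exact hrun.now_mono hj.le

/-- Many steps may share one time, so times order steps only across a positive gap. -/
theorem IsRun.le_of_delay_le (hrun : IsRun P faulty GST run) {k k' : ℕ}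
    (hk : (run k).now + P.Δ ≤ (run k').now) : k ≤ k' := by
  by_contra! hlt
  have h1 : (run k').now ≤ (run k).now := hrun.now_mono hlt.le
  have := P.Δ_pos
  linarith

theorem IsRun.sent_mem_log (hrun : IsRun P faulty GST run) {k k' : ℕ} {q : Fin n} {t : ℝ}
    {m : Msg n Tx Res} (hq : q ∉ faulty) (hm : (t, m) ∈ (run k).sent)
    (hGST : GST ≤ (run k).now) (hk : (run k).now + P.Δ ≤ (run k').now) :
    m ∈ ((run k').node q).log := by
  by_contra hlog
  have hkk : k ≤ k' := hrun.le_of_delay_le hk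
  have h1 := hrun.now_lt_of_not_mem_log hq (Or.inl (hrun.sent_mono hkk hm)) hlog
  have h2 := max_le (hrun.time_le_of_sent hm) hGST
  linarith

/-- Gossip: the delay bound also covers received messages, hence those of faulty senders that `p`
holds. -/
theorem IsRun.log_subset_log (hrun : IsRun P faulty GST run) {k k' : ℕ} {p q : Fin n}
    (hq : q ∉ faulty) (hGST : GST ≤ (run k).now)
    (hk : (run k).now + P.Δ ≤ (run k').now) :
    ((run k).node p).log ⊆ ((run k').node q).log := by
  intro m hm
  by_contra hlog
  have hkk : k ≤ k' := hrun.le_of_delay_le hk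
  obtain ⟨t, ht, hmr⟩ := hrun.received_of_mem_log hm
  have h1 := hrun.now_lt_of_not_mem_log hq (Or.inr (hrun.received_mono hkk hmr)) hlog
  have h2 := max_le ht hGST
  linarith

/-! ### Uniqueness of votes and quorums -/

/-- Correct nodes vote consistently. -/
theorem IsRun.vote_unique (hrun : IsRun P faulty GST run) {k k' : ℕ} {a b i : Fin n} {h r : ℕ}
    {v v' : Option (Block Tx Res)} {D D' : Option (Set Tx)} (hi : i ∉ faulty)
    (hm : ⟨i, h, r, .prevote v D true⟩ ∈ ((run k).node a).log)
    (hm' : ⟨i, h, r, .prevote v' D' true⟩ ∈ ((run k').node b).log) : v = v' := by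
  obtain ⟨t, ht⟩ := hrun.sent_of_mem_log hm hi
  obtain ⟨t', ht'⟩ := hrun.sent_of_mem_log hm' hi
  exact (hrun.localInv (max k k') i).unique h r v D v' D'
    ⟨rfl, t, hrun.sent_mono (le_max_left k k') ht⟩
    ⟨rfl, t', hrun.sent_mono (le_max_right k k') ht'⟩

theorem IsRun.quorum_unique (hrun : IsRun P faulty GST run) (hfaulty : faulty.ncard ≤ P.f)
    {k k' : ℕ} {a b : Fin n} {h r : ℕ} {v v' : Option (Block Tx Res)}
    (hv : P.quorum ≤ (prevoters ((run k).node a).log h r v).ncard)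
    (hv' : P.quorum ≤ (prevoters ((run k').node b).log h r v').ncard) : v = v' := by
  obtain ⟨i, ⟨D, hD⟩, ⟨D', hD'⟩, hi⟩ := exists_correct_of_quorums hfaulty hv hv'
  exact hrun.vote_unique hi hD hD'

/-! ### Timing of the prevote phase -/

/-- A prevote timer runs for at least `2Δ` after the first node has received a quorum of votes. -/
theorem IsRun.prevote_deadline (hrun : IsRun P faulty GST run) {h r k₀ : ℕ}
    (hk₀ : ∀ k < k₀, ∀ q, q ∉ faulty →
      ¬ P.quorum ≤ (anyPrevoters ((run k).node q).log h r).ncard)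
    {k : ℕ} {q : Fin n} (hh : ((run k).node q).height = h) (hr : ((run k).node q).round = r)
    {d : ℝ} (hd : ((run k).node q).tmrV = .on d) : (run k₀).now + 2 * P.Δ ≤ d := by
  induction k with
  | zero => simp [hrun.1, GlobalState.init, NodeState.init] at hd
  | succ k ih =>
    cases hrun.stepKind k with
    | stutter hS =>
      rw [hS] at hh hr hd
      exact ih hh hr hd
    | action p s' out hp ha hS =>
      rw [hS] at hh hr hd
      by_cases hqp : q = p
      · subst hqp
        simp only [GlobalState.act, Function.update_self] at hh hr hd
        cases (action_of_step ha).effect with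
        | advance _ _ _ hV => simp [hV] at hd
        | stay _ hheight hround _ _ _ _ hV _ =>
          rcases hV with hV | hV | ⟨hV, hquorum⟩
          · exact ih (hheight ▸ hh) (hround ▸ hr) (hV ▸ hd)
          · simp [hV] at hd
          · rw [← hheight, ← hround, hh, hr] at hquorum
            -- The timer is started now, which takes a quorum of votes and so cannot happen before
            -- `k₀`.
            have hle : k₀ ≤ k := by
              by_contra! hlt
              exact hk₀ k hlt q hp hquorum
            have h1 : (run k₀).now ≤ (run k).now := hrun.now_mono hle
            rw [hV] at hd
            injection hd with hd
            linarith
      · simp only [GlobalState.act, Function.update_of_ne hqp] at hh hr hd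
        exact ih hh hr hd
    | deliver p m hp hauth hS =>
      rw [hS] at hh hr hd
      by_cases hqp : q = p
      · subst hqp
        simp only [GlobalState.deliver, Function.update_self] at hh hr hd
        exact ih hh hr hd
      · simp only [GlobalState.deliver, Function.update_of_ne hqp] at hh hr hd
        exact ih hh hr hd
    | tick t' hle hq hnet hS =>
      rw [hS] at hh hr hd
      exact ih hh hr hd

/-- Before time reaches `T`, there is a last moment, at which all correct nodes are quiescent. -/
theorem IsRun.exists_tick (hrun : IsRun P faulty GST run) {k k' : ℕ} {T : ℝ}
    (hk : (run k).now < T) (hk' : T ≤ (run k').now) :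
    ∃ j, k ≤ j ∧ j < k' ∧ (run j).now < T ∧ T ≤ (run (j + 1)).now ∧
      (∀ p, p ∉ faulty → Quiescent P p (run j).now ((run j).node p)) ∧
      (run (j + 1)).node = (run j).node := by
  classical
  have hex : ∃ j, T ≤ (run j).now := ⟨k', hk'⟩
  have hmin : ∀ i, T ≤ (run i).now → k < i := by
    intro i hi
    by_contra! hle
    have h1 : (run i).now ≤ (run k).now := hrun.now_mono hle
    linarith
  -- The first step with time at least `T` is reached by a tick, since nothing else moves the clock,
  -- and a tick requires all correct nodes to be quiescent.
  obtain ⟨j, hj⟩ : ∃ j, Nat.find hex = j + 1 :=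
    Nat.exists_eq_succ_of_ne_zero (by have := hmin _ (Nat.find_spec hex); omega)
  have hT : T ≤ (run (j + 1)).now := hj ▸ Nat.find_spec hex
  have hlt : (run j).now < T := not_le.1 (Nat.find_min hex (by omega))
  have hjk' : j + 1 ≤ k' := hj ▸ Nat.find_min' hex hk'
  have hkj := hmin _ hT
  refine ⟨j, by omega, by omega, hlt, hT, ?_⟩
  cases hrun.stepKind j with
  | stutter hS => rw [hS] at hT; linarith
  | action p s' out hp ha hS =>
    rw [hS] at hT
    exact absurd hT (not_le.2 hlt)
  | deliver p m hp hauth hS =>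
    rw [hS] at hT
    exact absurd hT (not_le.2 hlt)
  | tick t' hle hq hnet hS => exact ⟨hq, by rw [hS]⟩

end Run

/-! ## Quiescent nodes -/

section Quiescent

variable {n : ℕ} {Tx Res : Type*} {P : Protocol n Tx Res} {p : Fin n} {now : ℝ}
  {s : NodeState n Tx Res}

theorem Quiescent.phase_ne_boot (hq : Quiescent P p now s) (v : Block Tx Res) :
    s.phase ≠ .boot := by
  intro hb
  obtain ⟨s', out, hs⟩ := exists_startRound P p now s 0 v
  exact hq _ _ (.start s s' out hb hs)

theorem Quiescent.not_decided (hq : Quiescent P p now s) : ¬ Decided P s.log s.height := by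
  rintro ⟨r, v, vr, rr, hprop, hquorum, hvalid⟩
  obtain ⟨s', out, hs⟩ := exists_startRound P p now _ 0 v
  exact hq _ _ (.decide s r v vr rr s' out (hq.phase_ne_boot v) hprop hquorum hvalid hs)

theorem Quiescent.round_ge (hq : Quiescent P p now s) (v : Block Tx Res) {r : ℕ}
    (hr : P.f + 1 ≤ (roundSenders s.log s.height r).ncard) : r ≤ s.round := by
  by_contra! hlt
  obtain ⟨s', out, hs⟩ := exists_startRound P p now s r v
  exact hq _ _ (.skipRound s r s' out (hq.phase_ne_boot v) hlt hr hs)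

/-- In the propose phase with a verified reference, approval or rejection is enabled; in every other
situation `endorseOnly` is, unless the flag is already set. -/
theorem Quiescent.endorsed (hq : Quiescent P p now s) {v : Block Tx Res} {rr : ℤ}
    (hprop : HasProposal P s.log s.height s.round v (-1) rr) (hvalid : P.valid s.height v) :
    s.endorsed = true := by
  by_contra he
  by_cases hc : s.phase = .propose ∧ ReferenceOK P s rr v
  · by_cases hl : s.lockedRound = -1 ∨ s.lockedValue = some v
    · exact hq _ _ (.approveNew s v rr hc.1 hprop hc.2 hvalid hl)
    · exact hq _ _ (.rejectNew s v rr hc.1 hprop hc.2 (fun hb => hl hb.2))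
  · exact hq _ _ (.endorseOnly s v rr (hq.phase_ne_boot v) hprop hvalid hc (by simpa using he))

end Quiescent

/-! ## Origins of messages and of new rounds -/

section Origin

variable {n : ℕ} {Tx Res : Type*} {P : Protocol n Tx Res} {p q : Fin n} {now : ℝ}
  {s s' : NodeState n Tx Res} {out : Set (Msg n Tx Res)} {h r : ℕ}

theorem StartRound.precommit_not_mem {r' : ℕ} {w : Option (Block Tx Res)} {R : Set Tx}
    (hs : StartRound P p now s r' s' out) :
    (⟨q, h, r, .precommit w R⟩ : Msg n Tx Res) ∉ out := by
  intro hm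
  obtain ⟨_, _, _, heq⟩ := hs.eq_proposal _ hm
  simp at heq

theorem StartRound.prevote_not_mem {r' : ℕ} {w : Option (Block Tx Res)} {D : Option (Set Tx)}
    {c : Bool} (hs : StartRound P p now s r' s' out) :
    (⟨q, h, r, .prevote w D c⟩ : Msg n Tx Res) ∉ out := by
  intro hm
  obtain ⟨_, _, _, heq⟩ := hs.eq_proposal _ hm
  simp at heq

/-- The circumstances in which a rule makes a node precommit. -/
inductive PrecommitByRule {n : ℕ} {Tx Res : Type*} (P : Protocol n Tx Res)
    (L : Set (Msg n Tx Res)) (h r : ℕ) (w : Option (Block Tx Res)) (R : Set Tx) : Prop where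
  | lock (v vr rr) (hw : w = some v) (hR : R = ∅) (hprop : HasProposal P L h r v vr rr)
      (hqc : P.quorum ≤ (prevoters L h r (some v)).ncard) (hvalid : P.valid h v)
      (hend : VerifyEndorsement P L h rr v ∨ VerifyEndorsement P L h r v)
  | nilQuorum (hR : R = ∅) (hqc : P.quorum ≤ (prevoters L h r none).ncard)
  | conflict (v vr rr v' vr' rr') (hR : R = ∅) (hprop : HasProposal P L h r v vr rr)
      (hprop' : HasProposal P L h r v' vr' rr') (hne : v ≠ v')
  | rapid (v) (hw : w = some v) (hR : R = excludedTx P L h r v)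
      (hqc : P.quorum ≤ (prevoters L h r (some v)).ncard)
      (hall : ∀ tx ∈ v.txs, ProperlyEndorsed P L h r v tx ∨ Vetoed P L h r v tx)

theorem Rule.precommit_origin {w : Option (Block Tx Res)} {R : Set Tx}
    (hr : Rule P p now s s' out) (hm : ⟨q, h, r, .precommit w R⟩ ∈ out) :
    q = p ∧ s.height = h ∧ s.round = r ∧ PrecommitByRule P s.log h r w R := by
  cases hr with
  | start s' out hphase hs => exact absurd hm hs.precommit_not_mem
  | decide r' v vr rr s' out hboot hprop hq hvalid hs => exact absurd hm hs.precommit_not_mem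
  | skipRound r' s' out hboot hr hq hs => exact absurd hm hs.precommit_not_mem
  | nextRound v vr rr s' out hboot hprop hq hupd hs => exact absurd hm hs.precommit_not_mem
  | lock v vr rr hphase hprop hqc hvalid hend =>
    simp only [Set.mem_singleton_iff, Msg.mk.injEq, Body.precommit.injEq] at hm
    obtain ⟨rfl, rfl, rfl, rfl, rfl⟩ := hm
    exact ⟨rfl, rfl, rfl, .lock v vr rr rfl rfl hprop hqc hvalid hend⟩
  | nilQuorum hphase hq =>
    simp only [Set.mem_singleton_iff, Msg.mk.injEq, Body.precommit.injEq] at hm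
    obtain ⟨rfl, rfl, rfl, rfl, rfl⟩ := hm
    exact ⟨rfl, rfl, rfl, .nilQuorum rfl hq⟩
  | conflict v vr rr v' vr' rr' hphase hprop hprop' hne =>
    simp only [Set.mem_singleton_iff, Msg.mk.injEq, Body.precommit.injEq] at hm
    obtain ⟨rfl, rfl, rfl, rfl, rfl⟩ := hm
    exact ⟨rfl, rfl, rfl, .conflict v vr rr v' vr' rr' rfl hprop hprop' hne⟩
  | rapid v rr hphase hprop hqc hvalid hall hsome =>
    simp only [Set.mem_singleton_iff, Msg.mk.injEq, Body.precommit.injEq] at hm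
    obtain ⟨rfl, rfl, rfl, rfl, rfl⟩ := hm
    exact ⟨rfl, rfl, rfl, .rapid v rfl rfl hqc hall⟩
  | _ => simp at hm

theorem Expire.precommit_origin {w : Option (Block Tx Res)} {R : Set Tx}
    (he : Expire P p now s s' out) (hm : ⟨q, h, r, .precommit w R⟩ ∈ out) :
    q = p ∧ s.height = h ∧ s.round = r ∧ s.phase = .prevote ∧ (∃ d ≤ now, s.tmrV = .on d) ∧
      ∀ v, w = some v → R = excludedTx P s.log h r v ∧
        P.quorum ≤ (prevoters s.log h r (some v)).ncard := by
  cases he with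
  | precommit d s' out ht hd hs => exact absurd hm hs.precommit_not_mem
  | prevoteValue d v rr ht hd hphase hprop hqc =>
    simp only [Set.mem_singleton_iff, Msg.mk.injEq, Body.precommit.injEq] at hm
    obtain ⟨rfl, rfl, rfl, rfl, rfl⟩ := hm
    refine ⟨rfl, rfl, rfl, hphase, ⟨d, hd, ht⟩, ?_⟩
    rintro _ ⟨⟩
    exact ⟨rfl, hqc⟩
  | prevoteNil d ht hd hphase hno =>
    simp only [Set.mem_singleton_iff, Msg.mk.injEq, Body.precommit.injEq] at hm
    obtain ⟨rfl, rfl, rfl, rfl, rfl⟩ := hm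
    exact ⟨rfl, rfl, rfl, hphase, ⟨d, hd, ht⟩, by simp⟩
  | _ => simp at hm

theorem Action.vote_origin {v : Block Tx Res} {D : Option (Set Tx)}
    (ha : Action P p now s s' out) (hm : ⟨q, h, r, .prevote (some v) D true⟩ ∈ out) :
    q = p ∧ s.height = h ∧ P.valid h v ∧
      ∃ vr rr, HasProposal P s.log h r v vr rr ∧ (vr = -1 ∨ VerifyEndorsement P s.log h rr v) := by
  rcases ha with ha | ha
  · cases ha with
    | start s' out hphase hs => exact absurd hm hs.prevote_not_mem
    | decide r' v vr rr s' out hboot hprop hq hvalid hs => exact absurd hm hs.prevote_not_mem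
    | skipRound r' s' out hboot hr hq hs => exact absurd hm hs.prevote_not_mem
    | nextRound v vr rr s' out hboot hprop hq hupd hs => exact absurd hm hs.prevote_not_mem
    | approveNew v' rr hphase hprop href hvalid hlock =>
      simp only [Set.mem_singleton_iff, Msg.mk.injEq, Body.prevote.injEq, Option.some.injEq] at hm
      obtain ⟨rfl, rfl, rfl, rfl, -⟩ := hm
      exact ⟨rfl, rfl, hvalid, -1, rr, hprop, Or.inl rfl⟩
    | approveOld v' vr rr hphase hprop hvr hqc hend hvalid hlock =>
      simp only [Set.mem_singleton_iff, Msg.mk.injEq, Body.prevote.injEq, Option.some.injEq] at hm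
      obtain ⟨rfl, rfl, rfl, rfl, -⟩ := hm
      exact ⟨rfl, rfl, hvalid, vr, rr, hprop, Or.inr hend⟩
    | _ => simp at hm
  · cases ha with
    | precommit d s' out ht hd hs => exact absurd hm hs.prevote_not_mem
    | _ => simp at hm

/-- Advancing within a height needs evidence: messages of the later round from `f + 1` nodes, or a
quorum of precommits of the present round, seen directly or through the running precommit timer. -/
theorem Action.round_origin (ha : Action P p now s s' out) (hheight : s'.height = s.height)
    (hround : s.round < s'.round) :
    P.f + 1 ≤ (roundSenders s.log s.height s'.round).ncard ∨
      (s'.round = s.round + 1 ∧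
        (P.quorum ≤ (anyPrecommitters s.log s.height s.round).ncard ∨ ∃ d, s.tmrC = .on d)) := by
  rcases ha with ha | ha
  · cases ha with
    | start s' out hphase hs =>
      obtain ⟨rfl, -⟩ := hs
      exact absurd hround (Nat.not_lt_zero _)
    | decide r' v vr rr s' out hboot hprop hq hvalid hs =>
      obtain ⟨rfl, -⟩ := hs
      exact absurd hheight (Nat.succ_ne_self _)
    | skipRound r' s' out hboot hr hq hs =>
      obtain ⟨rfl, -⟩ := hs
      exact Or.inl hq
    | nextRound v vr rr s' out hboot hprop hq hupd hs =>
      have hsub : precommitters s.log s.height s.round v ⊆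
          anyPrecommitters s.log s.height s.round := fun _ ⟨R, hR⟩ => ⟨some v, R, hR⟩
      obtain ⟨rfl, -⟩ := hs
      exact Or.inr ⟨rfl, Or.inl (ncard_le_of_subset hsub hq)⟩
    | _ => exact absurd hround (lt_irrefl _)
  · cases ha with
    | precommit d s' out ht hd hs =>
      obtain ⟨rfl, -⟩ := hs
      exact Or.inr ⟨rfl, Or.inr ⟨d, ht⟩⟩
    | _ => exact absurd hround (lt_irrefl _)

end Origin

/-! ## A node whose prevote timer expires -/

/-- At step `k₁` the correct node `p` is in the prevote phase with a quorum of votes for `v`, and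
no rule is enabled. -/
structure Waiting {n : ℕ} {Tx Res : Type*} (P : Protocol n Tx Res) (faulty : Set (Fin n))
    (run : ℕ → GlobalState n Tx Res) (h r : ℕ) (v : Block Tx Res) (p : Fin n) (k₁ : ℕ) :
    Prop where
  correct : p ∉ faulty
  quiescent : Quiescent P p (run k₁).now ((run k₁).node p)
  height : ((run k₁).node p).height = h
  round : ((run k₁).node p).round = r
  phase : ((run k₁).node p).phase = .prevote
  votes : P.quorum ≤ (prevoters ((run k₁).node p).log h r (some v)).ncard

namespace Waiting

variable {n : ℕ} {Tx Res : Type*} {P : Protocol n Tx Res} {faulty : Set (Fin n)} {GST : ℝ}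
  {run : ℕ → GlobalState n Tx Res} {h r : ℕ} {v : Block Tx Res} {p : Fin n} {k₁ : ℕ}

theorem not_decided (W : Waiting P faulty run h r v p k₁) :
    ¬ Decided P ((run k₁).node p).log h := by
  have := W.quiescent.not_decided
  rwa [W.height] at this

/-- Otherwise `lock` would be enabled at `p`, which holds the quorum of votes. -/
theorem not_verifyEndorsement (W : Waiting P faulty run h r v p k₁) {vr rr : ℤ}
    (hprop : HasProposal P ((run k₁).node p).log h r v vr rr) (hvalid : P.valid h v) :
    ¬ (VerifyEndorsement P ((run k₁).node p).log h rr v ∨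
      VerifyEndorsement P ((run k₁).node p).log h r v) := by
  obtain ⟨-, hq, rfl, rfl, hphase, hqc⟩ := W
  exact fun hend => hq _ _ (.lock _ v vr rr hphase hprop hqc hvalid hend)

theorem proposal_unique (W : Waiting P faulty run h r v p k₁) {w w' : Block Tx Res}
    {vr rr vr' rr' : ℤ} (hprop : HasProposal P ((run k₁).node p).log h r w vr rr)
    (hprop' : HasProposal P ((run k₁).node p).log h r w' vr' rr') : w = w' := by
  obtain ⟨-, hq, rfl, rfl, hphase, -⟩ := W
  by_contra hne
  exact hq _ _ (.conflict _ w vr rr w' vr' rr' (Or.inr hphase) hprop hprop' hne)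

/-- A node beyond height `h` holds a commit certificate for `h`; gossip would have brought it to
`p`, which would have decided. -/
theorem height_le (W : Waiting P faulty run h r v p k₁) (hrun : IsRun P faulty GST run) {k : ℕ}
    (hkG : GST ≤ (run k).now) (hkΔ : (run k).now + P.Δ ≤ (run k₁).now) {j : ℕ} (hjk : j ≤ k)
    (q : Fin n) : ((run j).node q).height ≤ h := by
  by_contra! hlt
  exact W.not_decided (((hrun.localInv j q).decided h hlt).mono
    ((hrun.log_mono q hjk).trans (hrun.log_subset_log W.correct hkG hkΔ)))

/-- The evidence for a precommit by a rule has reached `p` by step `k₁` and contradicts its waiting,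
or else contradicts the uniqueness of quorums or the absence of a veto. A precommit by timeout would
come before any prevote timer of the round can expire. -/
theorem precommit_not_sent (W : Waiting P faulty run h r v p k₁) (hrun : IsRun P faulty GST run)
    (hfaulty : faulty.ncard ≤ P.f) {tx : Tx} (htx : tx ∈ v.txs)
    (hnot : ¬ ProperlyEndorsed P ((run k₁).node p).log h r v tx)
    (hrapid : NotRapidlyRemovable P faulty run h r v tx) {k k₀ : ℕ}
    (hk₀ : ∀ k < k₀, ∀ q, q ∉ faulty →
      ¬ P.quorum ≤ (anyPrevoters ((run k).node q).log h r).ncard)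
    (hkG : GST ≤ (run k).now) (hkΔ : (run k).now + P.Δ ≤ (run k₁).now)
    (hkk₀ : (run k).now < (run k₀).now + 2 * P.Δ)
    {t : ℝ} {q : Fin n} {w : Option (Block Tx Res)} {R : Set Tx} :
    (t, ⟨q, h, r, .precommit w R⟩) ∉ (run k).sent := by
  intro hm
  obtain ⟨j, hjk, q', s', out, hq', hm, -, ha⟩ := hrun.exists_action_of_sent hm
  have hL : ((run j).node q').log ⊆ ((run k₁).node p).log :=
    (hrun.log_mono q' hjk.le).trans (hrun.log_subset_log W.correct hkG hkΔ)
  rcases ha with ha | ⟨-, ha⟩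
  · obtain ⟨rfl, -, -, hcase⟩ := ha.precommit_origin hm
    cases hcase with
    | lock w' vr rr hw hR hprop hqc hvalid hend =>
      obtain rfl : w' = v := Option.some_injective _ (hrun.quorum_unique hfaulty hqc W.votes)
      exact W.not_verifyEndorsement (hL hprop) hvalid (hend.imp (·.mono hL) (·.mono hL))
    | nilQuorum hR hqc => exact absurd (hrun.quorum_unique hfaulty hqc W.votes) (by simp)
    | conflict w vr rr w' vr' rr' hR hprop hprop' hne =>
      exact hne (W.proposal_unique (hL hprop) (hL hprop'))
    | rapid w' hw hR hqc hall =>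
      obtain rfl : w' = v := Option.some_injective _ (hrun.quorum_unique hfaulty hqc W.votes)
      rcases hall tx htx with hE | hV
      · exact hnot (hE.mono hL)
      · exact hrapid j q hq' hV
  · obtain ⟨rfl, hh, hr, -, ⟨d, hd, ht⟩, -⟩ := ha.precommit_origin hm
    have h1 := hrun.prevote_deadline hk₀ hh hr ht
    have h2 : (run j).now ≤ (run k).now := hrun.now_mono hjk.le
    linarith

/-- Induction along the run: the first correct node to pass round `r` would need either a correct
node already beyond it or a correct precommit of round `r`. -/
theorem round_le (W : Waiting P faulty run h r v p k₁) (hrun : IsRun P faulty GST run)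
    (hn : 3 * P.f + 1 ≤ n) (hfaulty : faulty.ncard ≤ P.f) {k : ℕ} (hkG : GST ≤ (run k).now)
    (hkΔ : (run k).now + P.Δ ≤ (run k₁).now)
    (hno : ∀ t q w R, (t, (⟨q, h, r, .precommit w R⟩ : Msg n Tx Res)) ∉ (run k).sent)
    {j : ℕ} (hjk : j ≤ k) {q : Fin n} (hq : q ∉ faulty)
    (hh : ((run j).node q).height = h) : ((run j).node q).round ≤ r := by
  induction j generalizing q with
  | zero => simp [hrun.1, GlobalState.init, NodeState.init]
  | succ j ih =>
    have hjk' : j ≤ k := by omega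
    cases hrun.stepKind j with
    | stutter hS =>
      rw [hS] at hh ⊢
      exact ih hjk' hq hh
    | action p' s' out hp ha hS =>
      rw [hS] at hh ⊢
      by_cases hqp : q = p'
      · subst hqp
        simp only [GlobalState.act, Function.update_self] at hh ⊢
        have ha' := action_of_step ha
        by_contra! hlt
        cases ha'.effect with
        | advance _ _ _ _ _ _ hpos =>
          rcases hpos with ⟨-, -, h0⟩ | ⟨hheight, hround⟩ | ⟨-, h0, -⟩
          · omega
          · have hr := ih hjk' hq (hheight ▸ hh)
            rcases ha'.round_origin hheight hround with hQ | ⟨hsucc, hQ⟩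
            · obtain ⟨i, ⟨b, hi⟩, hif⟩ := exists_correct_of_ncard hfaulty hQ
              have h1 := (hrun.localInv j i).pos _ ⟨rfl, hrun.sent_of_mem_log hi hif⟩
              have h2 := W.height_le hrun hkG hkΔ hjk' i
              have h3 := ih hjk' hif
              simp only at h1
              omega
            · have hQ' := hQ.elim id fun ⟨d, hd⟩ => (hrun.localInv j q).precommits d hd
              obtain ⟨i, ⟨w, R, hi⟩, hif⟩ :=
                exists_correct_of_ncard hfaulty ((P.succ_le_quorum hn).trans hQ')
              rw [← hheight, hh, show ((run j).node q).round = r by omega] at hi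
              obtain ⟨t, ht⟩ := hrun.sent_of_mem_log hi hif
              exact hno _ _ _ _ (hrun.sent_mono hjk' ht)
          · omega
        | stay _ hheight hround =>
          have := ih hjk' hq (hheight ▸ hh)
          omega
      · simp only [GlobalState.act, Function.update_of_ne hqp] at hh ⊢
        exact ih hjk' hq hh
    | deliver p' m hp hauth hS =>
      rw [hS] at hh ⊢
      by_cases hqp : q = p'
      · subst hqp
        simp only [GlobalState.deliver, Function.update_self] at hh ⊢
        exact ih hjk' hq hh
      · simp only [GlobalState.deliver, Function.update_of_ne hqp] at hh ⊢
        exact ih hjk' hq hh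
    | tick t' _ hq' hnet hS =>
      rw [hS] at hh ⊢
      exact ih hjk' hq hh

/-- The first correct node that has received a quorum of votes has received one of them from a
correct node that had a new proposal of `v`. -/
theorem exists_voter (W : Waiting P faulty run h r v p k₁) (hrun : IsRun P faulty GST run)
    (hfaulty : faulty.ncard ≤ P.f) (hGST : AfterGST GST run h r) {k₀ : ℕ} {a : Fin n}
    (hQ : P.quorum ≤ (anyPrevoters ((run k₀).node a).log h r).ncard)
    (hk₀ : (run k₀).now + P.Δ ≤ (run k₁).now) :
    GST ≤ (run k₀).now ∧ P.valid h v ∧ ∃ i, ((run k₀).node i).height ≥ h ∧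
      ∃ rr, HasProposal P ((run k₀).node i).log h r v (-1) rr := by
  obtain ⟨i, ⟨w, D, hi⟩, ⟨D', hi'⟩, hif⟩ := exists_correct_of_quorums hfaulty hQ W.votes
  obtain rfl : w = some v := hrun.vote_unique hif hi hi'
  obtain ⟨t, ht⟩ := hrun.sent_of_mem_log hi hif
  have hG : GST ≤ (run k₀).now := (hGST _ _ _ _ _ _ ht).trans (hrun.time_le_of_sent ht)
  obtain ⟨j, hj, q, s', out, hq, hm, -, ha⟩ := hrun.exists_action_of_sent ht
  obtain ⟨rfl, hh, hvalid, vr, rr, hprop, hvr⟩ := (action_of_step ha).vote_origin hm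
  have hpos := (hrun.localInv k₀ i).pos _ ⟨rfl, t, ht⟩
  simp only at hpos
  have hL := (hrun.log_mono i hj.le).trans (hrun.log_subset_log W.correct hG hk₀)
  rcases hvr with rfl | hend
  · exact ⟨hG, hvalid, i, by omega, rr, hrun.log_mono i hj.le hprop⟩
  -- A vote for an old proposal rests on a verified endorsement, with which `p` would have locked
  -- `v`.
  · exact absurd (Or.inl (hend.mono hL)) (W.not_verifyEndorsement (hL hprop) hvalid)

theorem properlyEndorsed (W : Waiting P faulty run h r v p k₁) (hrun : IsRun P faulty GST run)
    (hn : 3 * P.f + 1 ≤ n) (hfaulty : faulty.ncard ≤ P.f) (hGST : AfterGST GST run h r)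
    {tx : Tx} (htx : tx ∈ v.txs) (hend : EnoughEndorse P faulty h r v tx)
    (hrapid : NotRapidlyRemovable P faulty run h r v tx) {d : ℝ}
    (ht : ((run k₁).node p).tmrV = .on d) (hd : d ≤ (run k₁).now) :
    ProperlyEndorsed P ((run k₁).node p).log h r v tx := by
  classical
  by_contra hnot
  have hΔ := P.Δ_pos
  have hex : ∃ k a, a ∉ faulty ∧ P.quorum ≤ (anyPrevoters ((run k).node a).log h r).ncard :=
    ⟨k₁, p, W.correct, W.votes.trans
      (Set.ncard_le_ncard (fun _ ⟨D, hD⟩ => ⟨some v, D, hD⟩) (Set.toFinite _))⟩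
  obtain ⟨k₀, ⟨a, ha, hQ⟩, hk₀⟩ : ∃ k₀, (∃ a, a ∉ faulty ∧
      P.quorum ≤ (anyPrevoters ((run k₀).node a).log h r).ncard) ∧ ∀ k < k₀, ∀ q, q ∉ faulty →
      ¬ P.quorum ≤ (anyPrevoters ((run k).node q).log h r).ncard :=
    ⟨Nat.find hex, Nat.find_spec hex, fun k hk q hq hQ => Nat.find_min hex hk ⟨q, hq, hQ⟩⟩
  have hdeadline := (hrun.prevote_deadline hk₀ W.height W.round ht).trans hd
  obtain ⟨hG, hvalid, i, hih, rr, hprop⟩ :=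
    W.exists_voter hrun hfaulty hGST hQ (by linarith)
  -- At the last quiescent moment before `Δ` has passed since `k₀`, everything known at `k₀` has
  -- arrived everywhere, because the delay bound is strict; yet messages sent by then still reach
  -- `p` within the second `Δ`.
  obtain ⟨k, hk₀k, -, hkT, hkT', hquiet, hnode⟩ := hrun.exists_tick
    (k := k₀) (k' := k₁) (T := (run k₀).now + P.Δ) (by linarith) (by linarith)
  have hkG : GST ≤ (run k).now := hG.trans (hrun.now_mono hk₀k)
  have hkΔ : (run k).now + P.Δ ≤ (run k₁).now := by linarith
  have hlog (b : Fin n) {q : Fin n} (hq : q ∉ faulty) :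
      ((run k₀).node b).log ⊆ ((run k).node q).log := by
    have := hrun.log_subset_log (p := b) hq hG hkT'
    rwa [hnode] at this
  refine hnot (P.policy_mono _ _ _ _ _ ?_ hend)
  rintro q ⟨hq, hqtx⟩
  have hheight : ((run k).node q).height = h := by
    refine le_antisymm (W.height_le hrun hkG hkΔ le_rfl q) ?_
    by_contra! hlt
    -- The voter `i` had reached height `h`, so it held commit certificates for all lower heights,
    -- and `q` has them too.
    exact (hquiet q hq).not_decided
      (((hrun.localInv k₀ i).decided _ (hlt.trans_le hih)).mono (hlog i hq))
  have hround : ((run k).node q).round = r := by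
    refine le_antisymm (W.round_le hrun hn hfaulty hkG hkΔ (fun _ _ _ _ =>
      W.precommit_not_sent hrun hfaulty htx hnot hrapid hk₀ hkG hkΔ (by linarith)) le_rfl hq
      hheight) ?_
    -- The votes received by `a` are messages of round `r` from more than `f` nodes, so `q` cannot
    -- be in an earlier round.
    refine (hquiet q hq).round_ge v ((P.succ_le_quorum hn).trans (ncard_le_of_subset ?_ hQ))
    rw [hheight]
    exact fun _ ⟨_, _, hm⟩ => ⟨_, hlog a hq hm⟩
  have hendorsed : ((run k).node q).endorsed = true := by
    refine (hquiet q hq).endorsed (v := v) (rr := rr) ?_ (hheight ▸ hvalid)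
    rw [hheight, hround]
    exact hlog i hq hprop
  obtain ⟨w, rr', c, hw, -, t, hm⟩ := (hrun.localInv k q).endorsed hendorsed
  rw [hheight, hround] at hw hm
  -- The flag only says that some new proposal was endorsed; a proposal of a block other than `v`
  -- would have reached `p` and triggered `conflict`.
  obtain rfl : w = v := W.proposal_unique (hrun.log_subset_log W.correct hkG hkΔ hw)
    (hrun.log_subset_log W.correct hG (by linarith) hprop)
  exact Or.inl ⟨_, c, hrun.sent_mem_log W.correct hm hkG hkΔ, htx, hqtx⟩

end Waiting

end FlexTender

/-! ### Censorship resistance -/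

theorem mainTheorem5 {n : ℕ} {Tx Res : Type*} (P : FlexTender.Protocol n Tx Res)
    (hn : 3 * P.f + 1 ≤ n) (faulty : Set (Fin n)) (hfaulty : faulty.ncard ≤ P.f) (GST : ℝ)
    (run : ℕ → FlexTender.GlobalState n Tx Res) (hrun : FlexTender.IsRun P faulty GST run)
    (h r : ℕ) (hGST : FlexTender.AfterGST GST run h r)
    (v : FlexTender.Block Tx Res) (tx : Tx)
    (hend : FlexTender.EnoughEndorse P faulty h r v tx)
    (hrapid : FlexTender.NotRapidlyRemovable P faulty run h r v tx) :
    ∀ k p, p ∉ faulty → ¬ FlexTender.SuggestsRemoval run k p h r v tx := by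
  rintro k p - ⟨t, R, hsent, htx⟩
  obtain ⟨j, -, q, s', out, hq, hm, -, ha | ⟨hquiet, he⟩⟩ := hrun.exists_action_of_sent hsent
  · obtain ⟨rfl, -, -, hcase⟩ := ha.precommit_origin hm
    cases hcase with
    | rapid w hw hR hqc hall =>
      obtain rfl : v = w := Option.some_injective _ hw
      rw [hR] at htx
      exact (hall tx htx.1).elim htx.2 (hrapid j p hq)
    -- All other rules precommit with an empty set of removals.
    | _ => simp_all
  · obtain ⟨rfl, hheight, hround, hphase, ⟨d, hd, ht⟩, hR⟩ := he.precommit_origin hm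
    obtain ⟨hR, hqc⟩ := hR v rfl
    rw [hR] at htx
    -- Timers are handled only in quiescent states, which is what makes the inaction of `p`
    -- informative.
    have W : FlexTender.Waiting P faulty run h r v p j :=
      ⟨hq, hquiet, hheight, hround, hphase, hqc⟩
    exact htx.2 (W.properlyEndorsed hrun hn hfaulty hGST htx.1 hend hrapid ht hd)
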